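/- **Setting.** Let $d\ge 1$, $\Theta=[\theta_{inf},\theta_{sup}]^p$, and let $\{K_\theta,\theta\in\Theta\}$ be a family of stationary covariance functions on $\mathbb R^d$ with $K_\theta(0)=1$ for all $\theta\in\Theta$, such that: (i) $K_\theta(t)$ is three times differentiable in $\theta$ and, for all $0\le q\le 3$ and all $i_1,\dots,i_q$, there is $C_{i_1,\dots,i_q}<\infty$ with $\left|\frac{\partial}{\partial\theta_{i_1}}\cdots\frac{\partial}{\partial\theta_{i_q}}K_\theta(t)\right|\le \frac{C_{i_1,\dots,i_q}}{1+|t|^{d+1}}$ for all $\theta\in\Theta$, $t\in\mathbb R^d$ ($|\cdot|$ the Euclidean norm); (ii) with $\hat K_\theta(f)=(2\pi)^{-d}\int_{\mathbb R^d}K_\theta(t)e^{-\mathrm i f\cdot t}\,dt$, one has $K_\theta(t)=\int_{\mathbb R^d}\hat K_\theta(f)e^{\mathrm i f\cdot t}\,df$ (absolutely convergent); (iii) $(f,\theta)\mapsto\hat K_\theta(f)$ is continuous and positive on $\mathbb R^d\times\Theta$. Let $\theta_0$ satisfy $\theta_{inf}<(\theta_0)_i<\theta_{sup}$ for all $i$,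 and let $Y$ be a centered Gaussian process on $\mathbb R^d$ with covariance function $K_{\theta_0}$. Let $(v_i)_{i\ge1}$ be a sequence of points with $\{v_i:1\le i\le N^d\}=\{1,\dots,N\}^d$ for all $N\ge1$, let $\epsilon\in[0,\frac12)$, and let $X_1,X_2,\dots$ be i.i.d., independent of $Y$ (defined on the other factor of a product probability space), with a symmetric law $\mathcal L_X$ whose (topological) support $S_X$ is contained in $[-1,1]^d$ and which has a probability density that is positive on $S_X$. Put $y_i=Y(v_i+\epsilon X_i)$ and, for $1\le i\le n$, let $\hat y_{i,\theta}(y_{-i})=\mathbb E_{\theta|X}(y_i\mid y_1,\dots,y_{i-1},y_{i+1},\dots,y_n)$ be the Kriging leave-one-out prediction, i.e. the conditional expectation computed, with $X$ given, as if the covariance function of $Y$ were $K_\theta$. Let $$D_p(\theta,\theta_0)=\mathbb E\Big[\frac1n\sum_{i=1}^n\{y_i-\hat y_{i,\theta}(y_{-i})\}^2\Big]-\mathbb E\Big[\frac1n\sum_{i=1}^n\{y_i-\hat y_{i,\theta_0}(y_{-i})\}^2\Big],$$ which depends on $n$. **Proposition.** 1. Let $\epsilon=0$ and $I(\theta)=\sum_{v\in\mathbb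 Z^d}\{K_\theta(v)-K_{\theta_0}(v)\}^2$. Then $I(\theta)<\infty$ for all $\theta\in\Theta$, and there are constants $0<A<B<\infty$ such that for all $\theta\in\Theta$ $$A\,I(\theta)\le\liminf_{n\to\infty}D_p(\theta,\theta_0),\qquad \limsup_{n\to\infty}D_p(\theta,\theta_0)\le B\,I(\theta).$$ 2. Let $\epsilon\ne0$, $C_{S_X}=\{t_1-t_2:t_1,t_2\in S_X\}$, $D_\epsilon=\bigcup_{v\in\mathbb Z^d\setminus\{0\}}(v+\epsilon C_{S_X})$ and $I(\theta)=\int_{D_\epsilon}\{K_\theta(t)-K_{\theta_0}(t)\}^2\,dt$. Then $I(\theta)<\infty$ for all $\theta\in\Theta$, and for every $\delta>0$ there are constants $0<A<B<\infty$ such that, for all $\theta\in\Theta$ with $I(\theta)=0$ or $I(\theta)\ge\delta$, $$A\,I(\theta)\le\liminf_{n\to\infty}D_p(\theta,\theta_0),\qquad \limsup_{n\to\infty}D_p(\theta,\theta_0)\le B\,I(\theta).$$ In particular, for every fixed $\theta\in\Theta$ there are such constants $A,B$ (depending on $\theta$). -/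

import Mathlib

open MeasureTheory ProbabilityTheory Filter Topology
open scoped ENNReal

namespace KrigingLOO

/-- The parameter set `[θinf, θsup]^p`. -/
def paramSet (p : ℕ) (θinf θsup : ℝ) : Set (Fin p → ℝ) :=
  Set.Icc (fun _ => θinf) (fun _ => θsup)

/-- The covariance matrix `(k (s i - s j))` of the values at the points `s` of a process with
stationary covariance function `k`. -/
def covMatrix {d n : ℕ} (k : EuclideanSpace ℝ (Fin d) → ℝ) (s : Fin n → EuclideanSpace ℝ (Fin d)) :
    Matrix (Fin n) (Fin n) ℝ :=
  Matrix.of fun i j => k (s i - s j)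

/-- `k` is a stationary covariance function: all its finite matrices are symmetric and
positive semidefinite. -/
def IsStationaryCovariance {d : ℕ} (k : EuclideanSpace ℝ (Fin d) → ℝ) : Prop :=
  ∀ (n : ℕ) (s : Fin n → EuclideanSpace ℝ (Fin d)), (covMatrix k s).PosSemidef

/-- The iterated partial derivative `∂/∂θ_{i₁} ⋯ ∂/∂θ_{i_q} K_θ(t)` for the list `[i₁, …, i_q]`
(one-sided on the boundary of the parameter cube). -/
noncomputable def partialTheta {d p : ℕ} (θinf θsup : ℝ)
    (K : (Fin p → ℝ) → EuclideanSpace ℝ (Fin d) → ℝ) :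
    List (Fin p) → (Fin p → ℝ) → EuclideanSpace ℝ (Fin d) → ℝ
  | [] => K
  | i :: l => fun θ t =>
      derivWithin (fun u : ℝ => partialTheta θinf θsup K l (Function.update θ i u) t)
        (Set.Icc θinf θsup) (θ i)

/-- The Fourier transform `ĥ(f) = (2π)^{-d} ∫ h(t) e^{-i f·t} dt`. -/
noncomputable def fourierHat {d : ℕ} (h : EuclideanSpace ℝ (Fin d) → ℝ)
    (f : EuclideanSpace ℝ (Fin d)) : ℂ :=
  (1 / (2 * (Real.pi : ℂ)) ^ d) *
    ∫ t : EuclideanSpace ℝ (Fin d), (h t : ℂ) * Complex.exp (-Complex.I * ((inner ℝ f t : ℝ) : ℂ))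

/-- The regularity condition on the parametric family `K_θ`, `θ ∈ [θinf, θsup]^p`. -/
structure RegularModel {d p : ℕ} (θinf θsup : ℝ)
    (K : (Fin p → ℝ) → EuclideanSpace ℝ (Fin d) → ℝ) : Prop where
  /-- each `K_θ` is a stationary covariance function -/
  stationary : ∀ θ ∈ paramSet p θinf θsup, IsStationaryCovariance (K θ)
  /-- `K_θ` is three times differentiable in `θ` -/
  differentiable : ∀ l : List (Fin p), l.length < 3 → ∀ (i : Fin p),
    ∀ θ ∈ paramSet p θinf θsup, ∀ t : EuclideanSpace ℝ (Fin d),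
      DifferentiableWithinAt ℝ
        (fun u : ℝ => partialTheta θinf θsup K l (Function.update θ i u) t)
        (Set.Icc θinf θsup) (θ i)
  /-- the partial derivatives of order `0, …, 3` are bounded by `C / (1 + |t|^{d+1})` -/
  bound : ∀ l : List (Fin p), l.length ≤ 3 → ∃ C : ℝ,
    ∀ θ ∈ paramSet p θinf θsup, ∀ t : EuclideanSpace ℝ (Fin d),
      |partialTheta θinf θsup K l θ t| ≤ C / (1 + ‖t‖ ^ (d + 1))
  /-- Fourier inversion holds for `K_θ`, with an absolutely convergent integral -/
  integrable_hat : ∀ θ ∈ paramSet p θinf θsup, Integrable (fourierHat (K θ))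
  inversion : ∀ θ ∈ paramSet p θinf θsup, ∀ t : EuclideanSpace ℝ (Fin d),
    (K θ t : ℂ) = ∫ f : EuclideanSpace ℝ (Fin d),
      fourierHat (K θ) f * Complex.exp (Complex.I * ((inner ℝ f t : ℝ) : ℂ))
  /-- `(f, θ) ↦ K̂_θ(f)` is continuous -/
  continuous_hat : ContinuousOn
    (fun q : EuclideanSpace ℝ (Fin d) × (Fin p → ℝ) => fourierHat (K q.2) q.1)
    (Set.univ ×ˢ paramSet p θinf θsup)
  /-- `K̂_θ(f)` is real and positive -/
  pos_hat : ∀ θ ∈ paramSet p θinf θsup, ∀ f : EuclideanSpace ℝ (Fin d),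
    (fourierHat (K θ) f).im = 0 ∧ 0 < (fourierHat (K θ) f).re

/-- A point of `ℤ^d` as a point of `ℝ^d`. -/
noncomputable def latticePoint {d : ℕ} (u : Fin d → ℤ) : EuclideanSpace ℝ (Fin d) :=
  WithLp.toLp 2 fun k => (u k : ℝ)

/-- The first `N^d` points of the sequence fill the cube `{1, …, N}^d`, for every `N ≥ 1`
(indices start at `0`). -/
def IsGridEnumeration {d : ℕ} (v : ℕ → Fin d → ℤ) : Prop :=
  ∀ N : ℕ, 1 ≤ N →
    v '' {i | i < N ^ d} = {u : Fin d → ℤ | ∀ k, 1 ≤ u k ∧ u k ≤ (N : ℤ)}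

/-- A symmetric law whose (topological) support is contained in `[-1,1]^d`, with a probability
density function that is positive on the support. -/
structure IsPerturbationLaw {d : ℕ} (μ : Measure (EuclideanSpace ℝ (Fin d))) : Prop where
  probability : IsProbabilityMeasure μ
  symmetric : μ.map (fun x => -x) = μ
  support_subset : ∀ x ∈ μ.support, ∀ k, -1 ≤ x k ∧ x k ≤ 1
  density : ∃ f : EuclideanSpace ℝ (Fin d) → ℝ≥0∞, Measurable f ∧
    μ = volume.withDensity f ∧ ∀ x ∈ μ.support, 0 < f x

/-- The observation point `v_i + ε x_i`. -/
noncomputable def obsPoint {d : ℕ} (v : ℕ → Fin d → ℤ) (ε : ℝ)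
    (x : ℕ → EuclideanSpace ℝ (Fin d)) (i : ℕ) : EuclideanSpace ℝ (Fin d) :=
  latticePoint (v i) + ε • x i

/-- `Y` is a centered Gaussian process on `ℝ^d` with stationary covariance function `k`. -/
structure IsCenteredGaussianField {d : ℕ} {Ω : Type*} [MeasurableSpace Ω]
    (k : EuclideanSpace ℝ (Fin d) → ℝ) (Y : EuclideanSpace ℝ (Fin d) → Ω → ℝ)
    (P : Measure Ω) : Prop where
  gaussian : IsGaussianProcess Y P
  centered : ∀ t, ∫ ω, Y t ω ∂P = 0
  covariance : ∀ s t, cov[Y s, Y t; P] = k (s - t)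

/-- The Kriging leave-one-out prediction of `y_i` at fixed observation points `s`, as a function
of the data vector: the conditional expectation of the `i`-th coordinate given all the other
coordinates, under the centered Gaussian law with covariance function `k`.  (When the covariance
matrix is invertible, two versions of it agree Lebesgue almost everywhere.) -/
noncomputable def krigingPred {d n : ℕ} (k : EuclideanSpace ℝ (Fin d) → ℝ)
    (s : Fin n → EuclideanSpace ℝ (Fin d)) (i : Fin n) : EuclideanSpace ℝ (Fin n) → ℝ :=
  condExp
    (MeasurableSpace.comap (fun (y : EuclideanSpace ℝ (Fin n)) (j : {j : Fin n // j ≠ i}) => y j)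
      MeasurableSpace.pi)
    (multivariateGaussian 0 (covMatrix k s)) (fun y => y i)

/-- `E [ (1/n) ∑ i, (y_i - ŷ_i(y_{-i}))² ]`, where `y_i = Y (v_i + ε X_i)` and the prediction uses
the covariance function `k`.  `X` and `Y` live on the two factors of a product space, so the
expectation is the expectation over `X` of the expectation over `Y` with `X` fixed. -/
noncomputable def looMSE {d : ℕ} {ΩX ΩY : Type*} [MeasurableSpace ΩX] [MeasurableSpace ΩY]
    (k : EuclideanSpace ℝ (Fin d) → ℝ) (v : ℕ → Fin d → ℤ) (ε : ℝ)
    (X : ℕ → ΩX → EuclideanSpace ℝ (Fin d)) (PX : Measure ΩX)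
    (Y : EuclideanSpace ℝ (Fin d) → ΩY → ℝ) (PY : Measure ΩY) (n : ℕ) : ℝ≥0∞ :=
  ∫⁻ ωX, ∫⁻ ωY,
    (let s : Fin n → EuclideanSpace ℝ (Fin d) := fun i => obsPoint v ε (fun j => X j ωX) i
     let y : EuclideanSpace ℝ (Fin n) := WithLp.toLp 2 fun i => Y (s i) ωY
     ENNReal.ofReal ((1 / (n : ℝ)) * ∑ i : Fin n, (y i - krigingPred k s i y) ^ 2)) ∂PY ∂PX

/-- `D_p(θ, θ₀)` at sample size `n`, for `k = K_θ` and `k₀ = K_θ₀`. -/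
noncomputable def looExcess {d : ℕ} {ΩX ΩY : Type*} [MeasurableSpace ΩX] [MeasurableSpace ΩY]
    (k k₀ : EuclideanSpace ℝ (Fin d) → ℝ) (v : ℕ → Fin d → ℤ) (ε : ℝ)
    (X : ℕ → ΩX → EuclideanSpace ℝ (Fin d)) (PX : Measure ΩX)
    (Y : EuclideanSpace ℝ (Fin d) → ΩY → ℝ) (PY : Measure ΩY) (n : ℕ) : EReal :=
  (looMSE k v ε X PX Y PY n : EReal) - (looMSE k₀ v ε X PX Y PY n : EReal)

/-- `D_ε = ⋃_{v ∈ ℤ^d, v ≠ 0} (v + ε C_S)` with `C_S = {t₁ - t₂ : t₁, t₂ ∈ S}`. -/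
def diffDomain {d : ℕ} (ε : ℝ) (S : Set (EuclideanSpace ℝ (Fin d))) :
    Set (EuclideanSpace ℝ (Fin d)) :=
  {u | ∃ w : Fin d → ℤ, w ≠ 0 ∧ ∃ t₁ ∈ S, ∃ t₂ ∈ S, u = latticePoint w + ε • (t₁ - t₂)}

end KrigingLOO

/-! Write `R` and `R₀` for the covariance matrices of the observations under `K_θ` and `K_θ₀`.
Kriging residuals are `(R⁻¹ y)_i / (R⁻¹)_ii`, so `D_p(θ, θ₀)` is, up to the factor `1/n`, the
difference of the quadratic forms `tr (M R₀ Mᵀ)` for `M = diag(R⁻¹)⁻¹ R⁻¹` and for the analogous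
`M₀`. Since `M₀ R₀` is diagonal and `M - M₀` vanishes on the diagonal, this difference is
`tr ((M - M₀) R₀ (M - M₀)ᵀ)`. The eigenvalues of `R` and `R₀` are bounded above and below,
uniformly in `θ` and `n` (fast decay of `K_θ` and positivity of its Fourier transform on a separated
set of points), and `R` and `R₀` have equal diagonals, so the form is comparable to
`∑ i, ∑ j, (R i j - R₀ i j)²`.

Averaging over the grid turns this sum into the integral `J(θ)` of `(K_θ - K_θ₀)²` against the
intensity of the differences of observation points. For `ε = 0` that is the lattice sum `I(θ)`. For
`ε ≠ 0` the functions `I` and `J` are continuous on the compact parameter set and vanish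
simultaneously, hence are comparable where `δ ≤ I`. -/

namespace KrigingLOO

/-! ### Leave-one-out quadratic forms of well conditioned matrices -/

section WellConditioned

open Matrix
open scoped Matrix.Norms.Frobenius

variable {ι : Type*} [Fintype ι] {b : ℝ} {R R₀ : Matrix ι ι ℝ}

lemma le_of_sq_le_mul_self {x y : ℝ} (hy : 0 ≤ y) (h : x ^ 2 ≤ y * x) : x ≤ y := by
  by_contra! hyx
  nlinarith

lemma dotProduct_self_nonneg (z : ι → ℝ) : 0 ≤ z ⬝ᵥ z := dotProduct_star_self_nonneg z

lemma trace_mul_mul_transpose_eq_sum (M R : Matrix ι ι ℝ) :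
    (M * R * Mᵀ).trace = ∑ i, M.row i ⬝ᵥ R *ᵥ M.row i := by
  simp only [trace, row_apply, diag_apply, mul_apply, transpose_apply, dotProduct, mulVec,
    Finset.mul_sum, Finset.sum_mul]
  refine Finset.sum_congr rfl fun i _ => Finset.sum_comm.trans ?_
  exact Finset.sum_congr rfl fun _ _ => Finset.sum_congr rfl fun _ _ => mul_assoc ..

lemma sq_frobeniusNorm (M : Matrix ι ι ℝ) : ‖M‖ ^ 2 = ∑ i, ∑ j, M i j ^ 2 := by
  rw [frobenius_norm_def, ← Real.sqrt_eq_rpow, Real.sq_sqrt (by positivity)]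
  simp

lemma sq_frobeniusNorm_eq_sum_dotProduct (M : Matrix ι ι ℝ) :
    ‖M‖ ^ 2 = ∑ i, M.row i ⬝ᵥ M.row i := by
  rw [sq_frobeniusNorm]
  simp only [dotProduct, sq, row_apply]

lemma frobeniusNorm_diagonal_diag_le [DecidableEq ι] (M : Matrix ι ι ℝ) :
    ‖diagonal M.diag‖ ≤ ‖M‖ := by
  refine le_of_sq_le_sq ?_ (norm_nonneg M)
  rw [sq_frobeniusNorm, sq_frobeniusNorm]
  refine Finset.sum_le_sum fun i _ => Finset.sum_le_sum fun j _ => ?_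
  rcases eq_or_ne i j with rfl | h
  · simp
  · simpa [h] using sq_nonneg (M i j)

/-- A symmetric real matrix whose spectrum lies in `[b⁻¹, b]`, expressed through its quadratic form.
A single parameter makes the notion stable under inversion. -/
structure WellConditioned (b : ℝ) (R : Matrix ι ι ℝ) : Prop where
  one_le : 1 ≤ b
  isSymm : R.IsSymm
  lower : ∀ z : ι → ℝ, b⁻¹ * (z ⬝ᵥ z) ≤ z ⬝ᵥ R *ᵥ z
  upper : ∀ z : ι → ℝ, z ⬝ᵥ R *ᵥ z ≤ b * (z ⬝ᵥ z)

namespace WellConditioned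

lemma pos (h : WellConditioned b R) : 0 < b := one_pos.trans_le h.one_le

lemma form_nonneg (h : WellConditioned b R) (z : ι → ℝ) : 0 ≤ z ⬝ᵥ R *ᵥ z :=
  (mul_nonneg (inv_nonneg.2 h.pos.le) (dotProduct_self_nonneg z)).trans (h.lower z)

lemma dotProduct_self_le (h : WellConditioned b R) (z : ι → ℝ) :
    z ⬝ᵥ z ≤ b * (z ⬝ᵥ R *ᵥ z) :=
  (inv_mul_le_iff₀ h.pos).1 (h.lower z)

lemma form_comm (h : WellConditioned b R) (x y : ι → ℝ) : x ⬝ᵥ R *ᵥ y = y ⬝ᵥ R *ᵥ x := by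
  rw [dotProduct_mulVec, ← mulVec_transpose, h.isSymm.eq, dotProduct_comm]

lemma sq_form_le (h : WellConditioned b R) (x y : ι → ℝ) :
    (x ⬝ᵥ R *ᵥ y) ^ 2 ≤ (x ⬝ᵥ R *ᵥ x) * (y ⬝ᵥ R *ᵥ y) := by
  classical
  simpa [toBilin'_apply'] using LinearMap.BilinForm.apply_sq_le_of_symm (toBilin' R)
    (fun z => by simpa [toBilin'_apply'] using h.form_nonneg z)
    ⟨fun x y => by simpa [toBilin'_apply'] using h.form_comm x y⟩ x y

lemma posDef (h : WellConditioned b R) : R.PosDef := by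
  refine .of_dotProduct_mulVec_pos ((conjTranspose_eq_transpose_of_trivial R).trans h.isSymm)
    fun z hz => ?_
  have hzz : 0 < z ⬝ᵥ z := (dotProduct_self_nonneg z).lt_of_ne' (dotProduct_self_eq_zero.not.2 hz)
  simpa using (mul_pos (inv_pos.2 h.pos) hzz).trans_le (h.lower z)

lemma apply_self_mem_Icc (h : WellConditioned b R) (i : ι) : R i i ∈ Set.Icc b⁻¹ b := by
  classical
  simpa using And.intro (h.lower (Pi.single i 1)) (h.upper (Pi.single i 1))

lemma mulVec_dotProduct_mulVec_le (h : WellConditioned b R) (z : ι → ℝ) :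
    R *ᵥ z ⬝ᵥ R *ᵥ z ≤ b ^ 2 * (z ⬝ᵥ z) := by
  set y := R *ᵥ z
  refine le_of_sq_le_mul_self (mul_nonneg (sq_nonneg b) (dotProduct_self_nonneg z)) ?_
  calc (y ⬝ᵥ y) ^ 2 ≤ (y ⬝ᵥ R *ᵥ y) * (z ⬝ᵥ R *ᵥ z) := h.sq_form_le y z
    _ ≤ b * (y ⬝ᵥ y) * (b * (z ⬝ᵥ z)) :=
        mul_le_mul (h.upper y) (h.upper z) (h.form_nonneg z)
          (mul_nonneg h.pos.le (dotProduct_self_nonneg y))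
    _ = b ^ 2 * (z ⬝ᵥ z) * (y ⬝ᵥ y) := by ring

lemma norm_mul_le (h : WellConditioned b R) (M : Matrix ι ι ℝ) : ‖M * R‖ ≤ b * ‖M‖ := by
  refine le_of_sq_le_sq ?_ (mul_nonneg h.pos.le (norm_nonneg M))
  rw [mul_pow, sq_frobeniusNorm_eq_sum_dotProduct, sq_frobeniusNorm_eq_sum_dotProduct,
    Finset.mul_sum]
  refine Finset.sum_le_sum fun i _ => ?_
  have hrow : (M * R).row i = R *ᵥ M.row i := by
    rw [row_apply', mul_apply_eq_vecMul, ← mulVec_transpose, h.isSymm.eq, row_apply']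
  exact hrow ▸ h.mulVec_dotProduct_mulVec_le (M.row i)

lemma norm_mul_le' (h : WellConditioned b R) (M : Matrix ι ι ℝ) : ‖R * M‖ ≤ b * ‖M‖ := by
  rw [← frobenius_norm_transpose, ← frobenius_norm_transpose M, transpose_mul, h.isSymm.eq]
  exact h.norm_mul_le Mᵀ

variable [DecidableEq ι]

lemma isUnit_det (h : WellConditioned b R) : IsUnit R.det := h.posDef.det_pos.ne'.isUnit

lemma mulVec_inv_mulVec (h : WellConditioned b R) (z : ι → ℝ) : R *ᵥ (R⁻¹ *ᵥ z) = z := by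
  rw [mulVec_mulVec, mul_nonsing_inv _ h.isUnit_det, one_mulVec]

protected lemma inv (h : WellConditioned b R) : WellConditioned b R⁻¹ := by
  have inv_form (z : ι → ℝ) : R⁻¹ *ᵥ z ⬝ᵥ R *ᵥ (R⁻¹ *ᵥ z) = z ⬝ᵥ R⁻¹ *ᵥ z := by
    rw [h.mulVec_inv_mulVec, dotProduct_comm]
  have inv_form_nonneg (z : ι → ℝ) : 0 ≤ z ⬝ᵥ R⁻¹ *ᵥ z := inv_form z ▸ h.form_nonneg _
  refine ⟨h.one_le, by rw [IsSymm, transpose_nonsing_inv, h.isSymm.eq], fun z => ?_, fun z => ?_⟩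
  · rw [inv_mul_le_iff₀ h.pos]
    refine le_of_sq_le_mul_self (mul_nonneg h.pos.le (inv_form_nonneg z)) ?_
    calc (z ⬝ᵥ z) ^ 2 = (z ⬝ᵥ R *ᵥ (R⁻¹ *ᵥ z)) ^ 2 := by rw [h.mulVec_inv_mulVec]
      _ ≤ (z ⬝ᵥ R *ᵥ z) * (z ⬝ᵥ R⁻¹ *ᵥ z) := by
          simpa only [inv_form] using h.sq_form_le z (R⁻¹ *ᵥ z)
      _ ≤ b * (z ⬝ᵥ z) * (z ⬝ᵥ R⁻¹ *ᵥ z) :=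
          mul_le_mul_of_nonneg_right (h.upper z) (inv_form_nonneg z)
      _ = b * (z ⬝ᵥ R⁻¹ *ᵥ z) * (z ⬝ᵥ z) := by ring
  · refine le_of_sq_le_mul_self (mul_nonneg h.pos.le (dotProduct_self_nonneg z)) ?_
    calc (z ⬝ᵥ R⁻¹ *ᵥ z) ^ 2 ≤ (z ⬝ᵥ z) * (R⁻¹ *ᵥ z ⬝ᵥ R⁻¹ *ᵥ z) := by
          simpa [dotProduct, sq] using Finset.sum_mul_sq_le_sq_mul_sq Finset.univ z (R⁻¹ *ᵥ z)
      _ ≤ (z ⬝ᵥ z) * (b * (z ⬝ᵥ R⁻¹ *ᵥ z)) :=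
          mul_le_mul_of_nonneg_left (inv_form z ▸ h.dotProduct_self_le (R⁻¹ *ᵥ z))
            (dotProduct_self_nonneg z)
      _ = b * (z ⬝ᵥ z) * (z ⬝ᵥ R⁻¹ *ᵥ z) := by ring

protected lemma diagonal_diag (h : WellConditioned b R) :
    WellConditioned b (diagonal R.diag) := by
  refine ⟨h.one_le, diagonal_transpose _, fun z => ?_, fun z => ?_⟩
  all_goals
    simp only [dotProduct, mulVec_diagonal, Finset.mul_sum, diag_apply]
    refine Finset.sum_le_sum fun i _ => ?_
    nlinarith [(h.apply_self_mem_Icc i).1, (h.apply_self_mem_Icc i).2, mul_self_nonneg (z i)]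

lemma norm_inv_sub_inv_le (h : WellConditioned b R) (h₀ : WellConditioned b R₀) :
    ‖R⁻¹ - R₀⁻¹‖ ≤ b ^ 2 * ‖R - R₀‖ := by
  have hb := h.pos.le
  calc ‖R⁻¹ - R₀⁻¹‖ = ‖R⁻¹ * (R₀ - R) * R₀⁻¹‖ := by
        rw [inv_sub_inv (iff_of_true h.posDef.isUnit h₀.posDef.isUnit)]
    _ ≤ b * (b * ‖R₀ - R‖) := by
        grw [h₀.inv.norm_mul_le, h.inv.norm_mul_le']
    _ = b ^ 2 * ‖R - R₀‖ := by rw [norm_sub_rev]; ring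

end WellConditioned

/-- The matrix mapping a data vector with covariance matrix `R` to the vector of its leave-one-out
residuals: the inverse of `R`, with rows rescaled so as to have a unit diagonal. -/
noncomputable def looMatrix [DecidableEq ι] (R : Matrix ι ι ℝ) : Matrix ι ι ℝ :=
  (diagonal R⁻¹.diag)⁻¹ * R⁻¹

/-- The sum of the variances of the leave-one-out residuals computed from `R` when the data have
covariance matrix `R₀`. -/
noncomputable def looForm [DecidableEq ι] (R R₀ : Matrix ι ι ℝ) : ℝ :=
  (looMatrix R * R₀ * (looMatrix R)ᵀ).trace

namespace WellConditioned

lemma sq_norm_le_trace (h : WellConditioned b R) (M : Matrix ι ι ℝ) :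
    b⁻¹ * ‖M‖ ^ 2 ≤ (M * R * Mᵀ).trace := by
  rw [sq_frobeniusNorm_eq_sum_dotProduct, trace_mul_mul_transpose_eq_sum, Finset.mul_sum]
  exact Finset.sum_le_sum fun i _ => h.lower (M.row i)

lemma trace_le_sq_norm (h : WellConditioned b R) (M : Matrix ι ι ℝ) :
    (M * R * Mᵀ).trace ≤ b * ‖M‖ ^ 2 := by
  rw [sq_frobeniusNorm_eq_sum_dotProduct, trace_mul_mul_transpose_eq_sum, Finset.mul_sum]
  exact Finset.sum_le_sum fun i _ => h.upper (M.row i)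

variable [DecidableEq ι]

lemma looMatrix_mul (h : WellConditioned b R) :
    looMatrix R * R = (diagonal R⁻¹.diag)⁻¹ := by
  rw [looMatrix, mul_assoc, nonsing_inv_mul _ h.isUnit_det, mul_one]

lemma looMatrix_apply_self (h : WellConditioned b R) (i : ι) : looMatrix R i i = 1 := by
  have hD := h.inv.diagonal_diag
  have hdiag : (diagonal R⁻¹.diag * looMatrix R) i i = R⁻¹ i i := by
    rw [looMatrix, ← mul_assoc, mul_nonsing_inv _ hD.isUnit_det, one_mul]
  rw [diagonal_mul, diag_apply] at hdiag
  exact (mul_eq_left₀ h.inv.posDef.diag_pos.ne').1 hdiag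

lemma looForm_sub_looForm_self (h : WellConditioned b R) (h₀ : WellConditioned b R₀) :
    looForm R R₀ - looForm R₀ R₀ =
      ((looMatrix R - looMatrix R₀) * R₀ * (looMatrix R - looMatrix R₀)ᵀ).trace := by
  set A := looMatrix R with hA
  set A₀ := looMatrix R₀ with hA₀
  have cross : (A₀ * R₀ * (A - A₀)ᵀ).trace = 0 := by
    obtain ⟨a, ha⟩ : ∃ a, A₀ * R₀ = diagonal a := by
      rw [hA₀, h₀.looMatrix_mul, inv_diagonal]
      exact ⟨_, rfl⟩
    rw [ha]
    simp [trace, hA, hA₀, h.looMatrix_apply_self, h₀.looMatrix_apply_self]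
  have cross' : ((A - A₀) * R₀ * A₀ᵀ).trace = 0 := by
    rw [← trace_transpose, ← cross]
    simp [h₀.isSymm.eq, mul_assoc]
  calc (A * R₀ * Aᵀ).trace - (A₀ * R₀ * A₀ᵀ).trace
      = (((A - A₀) + A₀) * R₀ * ((A - A₀) + A₀)ᵀ).trace - (A₀ * R₀ * A₀ᵀ).trace := by
        rw [sub_add_cancel]
    _ = ((A - A₀) * R₀ * (A - A₀)ᵀ).trace := by
        simp only [transpose_add, add_mul, mul_add, trace_add, cross, cross']
        ring

lemma norm_looMatrix_sub_le (h : WellConditioned b R) (h₀ : WellConditioned b R₀) :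
    ‖looMatrix R - looMatrix R₀‖ ≤ 2 * b ^ 5 * ‖R - R₀‖ := by
  set D := diagonal R⁻¹.diag
  set D₀ := diagonal R₀⁻¹.diag
  have hb := h.pos.le
  have hinv := h.norm_inv_sub_inv_le h₀
  have hD : ‖D - D₀‖ ≤ b ^ 2 * ‖R - R₀‖ := by
    have hsub : D - D₀ = diagonal (R⁻¹ - R₀⁻¹).diag := diagonal_sub _ _
    exact hsub ▸ (frobeniusNorm_diagonal_diag_le _).trans hinv
  have hDinv : ‖D⁻¹ - D₀⁻¹‖ ≤ b ^ 4 * ‖R - R₀‖ := by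
    grw [h.inv.diagonal_diag.norm_inv_sub_inv_le h₀.inv.diagonal_diag, hD]
    exact le_of_eq (by ring)
  calc ‖looMatrix R - looMatrix R₀‖
      = ‖D⁻¹ * (R⁻¹ - R₀⁻¹) + (D⁻¹ - D₀⁻¹) * R₀⁻¹‖ := by
        congr 1; simp only [looMatrix, D, D₀, mul_sub, sub_mul]; abel
    _ ≤ b * (b ^ 2 * ‖R - R₀‖) + b * (b ^ 4 * ‖R - R₀‖) := by
        grw [norm_add_le, h.inv.diagonal_diag.inv.norm_mul_le', h₀.inv.norm_mul_le, hinv, hDinv]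
    _ = (b ^ 3 + b ^ 5) * ‖R - R₀‖ := by ring
    _ ≤ 2 * b ^ 5 * ‖R - R₀‖ := by
        rw [two_mul]
        gcongr
        exacts [h.one_le, by norm_num]

lemma norm_mul_diagonal_sub_le (h : WellConditioned b R) (h₀ : WellConditioned b R₀) :
    ‖R * diagonal R⁻¹.diag - R₀ * diagonal R₀⁻¹.diag‖ ≤
      b ^ 4 * ‖looMatrix R - looMatrix R₀‖ := by
  set D := diagonal R⁻¹.diag
  set D₀ := diagonal R₀⁻¹.diag
  set A := looMatrix R with hA
  set A₀ := looMatrix R₀ with hA₀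
  have hD : WellConditioned b D := h.inv.diagonal_diag
  have hD₀ : WellConditioned b D₀ := h₀.inv.diagonal_diag
  have hb := h.pos.le
  have hRDA : R * D * A = 1 := by
    rw [hA, looMatrix, mul_assoc, mul_nonsing_inv_cancel_left _ _ hD.isUnit_det,
      mul_nonsing_inv _ h.isUnit_det]
  have hARD : A₀ * R₀ * D₀ = 1 := by
    rw [hA₀, h₀.looMatrix_mul, nonsing_inv_mul _ hD₀.isUnit_det]
  calc ‖R * D - R₀ * D₀‖ = ‖R * (D * ((A₀ - A) * R₀ * D₀))‖ := by
        congr 1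
        rw [sub_mul, sub_mul, hARD, ← mul_assoc, mul_sub, mul_one, mul_assoc A, ← mul_assoc (R * D),
          hRDA, one_mul]
    _ ≤ b * (b * (b * (b * ‖A₀ - A‖))) := by
        grw [h.norm_mul_le', hD.norm_mul_le', hD₀.norm_mul_le, h₀.norm_mul_le]
    _ = b ^ 4 * ‖A - A₀‖ := by rw [norm_sub_rev]; ring

lemma norm_sub_le_norm_looMatrix_sub (h : WellConditioned b R) (h₀ : WellConditioned b R₀)
    (hdiag : R.diag = 1) (hdiag₀ : R₀.diag = 1) :
    ‖R - R₀‖ ≤ 2 * b ^ 8 * ‖looMatrix R - looMatrix R₀‖ := by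
  set D := diagonal R⁻¹.diag
  set D₀ := diagonal R₀⁻¹.diag
  set x := ‖looMatrix R - looMatrix R₀‖
  have hD : WellConditioned b D := h.inv.diagonal_diag
  have hD₀ : WellConditioned b D₀ := h₀.inv.diagonal_diag
  have hb := h.pos.le
  have hRD : ‖R * D - R₀ * D₀‖ ≤ b ^ 4 * x := h.norm_mul_diagonal_sub_le h₀
  have hDD₀ : ‖D - D₀‖ ≤ b ^ 4 * x := by
    have hsub : D - D₀ = diagonal (R * D - R₀ * D₀).diag := by
      refine (diagonal_sub _ _).trans (congrArg diagonal (funext fun i => ?_))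
      have hi : R i i = 1 := congr_fun hdiag i
      have hi₀ : R₀ i i = 1 := congr_fun hdiag₀ i
      simp [D, D₀, hi, hi₀]
    exact hsub ▸ (frobeniusNorm_diagonal_diag_le _).trans hRD
  have hDinv : ‖D⁻¹ - D₀⁻¹‖ ≤ b ^ 6 * x := by
    grw [hD.norm_inv_sub_inv_le hD₀, hDD₀]
    exact le_of_eq (by ring)
  calc ‖R - R₀‖ = ‖(R * D - R₀ * D₀) * D⁻¹ + R₀ * (D₀ * (D⁻¹ - D₀⁻¹))‖ := by
        congr 1
        rw [sub_mul, mul_nonsing_inv_cancel_right _ _ hD.isUnit_det, mul_sub,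
          mul_nonsing_inv _ hD₀.isUnit_det, mul_sub, mul_one, mul_assoc R₀]
        abel
    _ ≤ b * (b ^ 4 * x) + b * (b * (b ^ 6 * x)) := by
        grw [norm_add_le, hD.inv.norm_mul_le, h₀.norm_mul_le', hD₀.norm_mul_le', hRD, hDinv]
    _ = (b ^ 5 + b ^ 8) * x := by ring
    _ ≤ 2 * b ^ 8 * x := by
        rw [two_mul]
        gcongr
        exacts [h.one_le, by norm_num]

lemma looForm_sub_looForm_self_le (h : WellConditioned b R) (h₀ : WellConditioned b R₀) :
    looForm R R₀ - looForm R₀ R₀ ≤ 4 * b ^ 11 * ∑ i, ∑ j, (R i j - R₀ i j) ^ 2 := by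
  have hb := h.pos.le
  calc looForm R R₀ - looForm R₀ R₀ ≤ b * ‖looMatrix R - looMatrix R₀‖ ^ 2 := by
        rw [h.looForm_sub_looForm_self h₀]
        exact h₀.trace_le_sq_norm _
    _ ≤ b * (2 * b ^ 5 * ‖R - R₀‖) ^ 2 := by grw [h.norm_looMatrix_sub_le h₀]
    _ = 4 * b ^ 11 * ‖R - R₀‖ ^ 2 := by ring
    _ = 4 * b ^ 11 * ∑ i, ∑ j, (R i j - R₀ i j) ^ 2 := by
        simp only [sq_frobeniusNorm, Matrix.sub_apply]

lemma le_looForm_sub_looForm_self (h : WellConditioned b R) (h₀ : WellConditioned b R₀)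
    (hdiag : R.diag = 1) (hdiag₀ : R₀.diag = 1) :
    (4 * b ^ 17)⁻¹ * ∑ i, ∑ j, (R i j - R₀ i j) ^ 2 ≤ looForm R R₀ - looForm R₀ R₀ := by
  have hb := h.pos
  calc (4 * b ^ 17)⁻¹ * ∑ i, ∑ j, (R i j - R₀ i j) ^ 2 = (4 * b ^ 17)⁻¹ * ‖R - R₀‖ ^ 2 := by
        simp only [sq_frobeniusNorm, Matrix.sub_apply]
    _ ≤ (4 * b ^ 17)⁻¹ * (2 * b ^ 8 * ‖looMatrix R - looMatrix R₀‖) ^ 2 := by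
        grw [h.norm_sub_le_norm_looMatrix_sub h₀ hdiag hdiag₀]
    _ = b⁻¹ * ‖looMatrix R - looMatrix R₀‖ ^ 2 := by field
    _ ≤ looForm R R₀ - looForm R₀ R₀ := by
        rw [h.looForm_sub_looForm_self h₀]
        exact h₀.sq_norm_le_trace _

lemma looForm_nonneg (h₀ : WellConditioned b R₀) : 0 ≤ looForm R R₀ :=
  (mul_nonneg (inv_nonneg.2 h₀.pos.le) (sq_nonneg _)).trans (h₀.sq_norm_le_trace (looMatrix R))

lemma looForm_self_le (h : WellConditioned b R) : looForm R R ≤ b * Fintype.card ι := by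
  have hdiag : looForm R R = ∑ i, (diagonal R⁻¹.diag)⁻¹ i i := by
    rw [looForm, h.looMatrix_mul, inv_diagonal]
    simp [trace, h.looMatrix_apply_self]
  rw [hdiag, mul_comm, ← nsmul_eq_mul]
  exact Finset.sum_le_card_nsmul _ _ _ fun i _ => (h.inv.diagonal_diag.inv.apply_self_mem_Icc i).2

end WellConditioned
end WellConditioned

/-! ### Kriging residuals of Gaussian vectors -/

section AbsoluteContinuity

open Matrix
open scoped MatrixOrder

lemma pi_absolutelyContinuous_pi : ∀ {n : ℕ} {α : Fin n → Type*} [∀ i, MeasurableSpace (α i)]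
    {μ ν : ∀ i, Measure (α i)} [∀ i, SigmaFinite (μ i)] [∀ i, SigmaFinite (ν i)],
    (∀ i, μ i ≪ ν i) → Measure.pi μ ≪ Measure.pi ν
  | 0, _, _, _, _, _, _, _ => by rw [Measure.pi_of_empty, Measure.pi_of_empty]
  | _ + 1, α, _, μ, ν, _, _, h => by
    have hprod := ((h 0).prod (pi_absolutelyContinuous_pi fun i => h (Fin.succAbove 0 i))).map
      (MeasurableEquiv.piFinSuccAbove α 0).symm.measurable
    rwa [((measurePreserving_piFinSuccAbove μ 0).symm _).map_eq,
      ((measurePreserving_piFinSuccAbove ν 0).symm _).map_eq] at hprod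

variable {n : ℕ}

lemma volume_absolutelyContinuous_stdGaussian :
    (volume : Measure (EuclideanSpace ℝ (Fin n))) ≪ stdGaussian (EuclideanSpace ℝ (Fin n)) := by
  rw [← map_pi_eq_stdGaussian, ← (PiLp.volume_preserving_toLp (Fin n)).map_eq]
  exact (pi_absolutelyContinuous_pi fun _ =>
    gaussianReal_absolutelyContinuous' 0 one_ne_zero).map (by fun_prop)

lemma stdGaussian_absolutelyContinuous_volume :
    stdGaussian (EuclideanSpace ℝ (Fin n)) ≪ (volume : Measure (EuclideanSpace ℝ (Fin n))) := by
  rw [← map_pi_eq_stdGaussian, ← (PiLp.volume_preserving_toLp (Fin n)).map_eq]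
  exact (pi_absolutelyContinuous_pi fun _ =>
    gaussianReal_absolutelyContinuous 0 one_ne_zero).map (by fun_prop)

lemma det_toEuclideanCLM_sqrt_ne_zero {R : Matrix (Fin n) (Fin n) ℝ} (hR : R.PosDef) :
    (toEuclideanCLM (𝕜 := ℝ) (CFC.sqrt R) :
      EuclideanSpace ℝ (Fin n) →L[ℝ] EuclideanSpace ℝ (Fin n)).toLinearMap.det ≠ 0 :=
  ((((CFC.isUnit_sqrt_iff R hR.posSemidef.nonneg).2 hR.isUnit).map
    (toEuclideanCLM (n := Fin n) (𝕜 := ℝ))).map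
      ContinuousLinearMap.toLinearMapRingHom).map LinearMap.det |>.ne_zero

lemma multivariateGaussian_absolutelyContinuous {R R₀ : Matrix (Fin n) (Fin n) ℝ}
    (hR : R.PosDef) (hR₀ : R₀.PosDef) :
    multivariateGaussian 0 R₀ ≪ multivariateGaussian 0 R := by
  have to_volume : multivariateGaussian 0 R₀ ≪ volume := by
    have h := (stdGaussian_absolutelyContinuous_volume (n := n)).map
      (f := toEuclideanCLM (𝕜 := ℝ) (CFC.sqrt R₀)) (by fun_prop)
    have hmap := Measure.map_linearMap_addHaar_eq_smul_addHaar volume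
      (det_toEuclideanCLM_sqrt_ne_zero hR₀)
    simpa only [multivariateGaussian, zero_add] using
      h.trans (hmap ▸ Measure.smul_absolutelyContinuous)
  have of_volume : volume ≪ multivariateGaussian 0 R := by
    have h := (volume_absolutelyContinuous_stdGaussian (n := n)).map
      (f := toEuclideanCLM (𝕜 := ℝ) (CFC.sqrt R)) (by fun_prop)
    have hdet := det_toEuclideanCLM_sqrt_ne_zero hR
    have hmap := Measure.map_linearMap_addHaar_eq_smul_addHaar volume hdet
    simpa only [multivariateGaussian, zero_add] using
      (Measure.absolutelyContinuous_smul (by simp [hdet])).trans (hmap ▸ h)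
  exact to_volume.trans of_volume

end AbsoluteContinuity

section GaussianVector

open Matrix

variable {ι : Type*} [Fintype ι]

lemma stronglyMeasurable_sub_dotProduct {i : ι} {a : ι → ℝ} (ha : a i = 1) :
    StronglyMeasurable[MeasurableSpace.comap
      (fun (y : EuclideanSpace ℝ ι) (j : {j // j ≠ i}) => y j) MeasurableSpace.pi]
      fun y => y i - a ⬝ᵥ y.ofLp := by
  classical
  have hsplit : (fun y : EuclideanSpace ℝ ι => y i - a ⬝ᵥ y.ofLp) =
      (fun z : {j // j ≠ i} → ℝ => -∑ j : {j // j ≠ i}, a j * z j) ∘ fun y j => y j := by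
    ext y
    rw [Function.comp_apply, dotProduct, Fintype.sum_eq_add_sum_subtype_ne _ i, ha]
    ring
  rw [hsplit]
  exact (Measurable.stronglyMeasurable (by fun_prop)).comp_measurable (comap_measurable _)

variable [DecidableEq ι] {S : Matrix ι ι ℝ}

lemma memLp_dotProduct_multivariateGaussian (a : ι → ℝ) :
    MemLp (fun y : EuclideanSpace ℝ ι => a ⬝ᵥ y.ofLp) 2 (multivariateGaussian 0 S) := by
  simpa [EuclideanSpace.inner_eq_star_dotProduct, dotProduct_comm] using
    (IsGaussian.hasGaussianLaw_id (μ := multivariateGaussian 0 S)).map_fun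
      (innerSL ℝ (WithLp.toLp 2 a)) |>.memLp_two

lemma integral_dotProduct_multivariateGaussian (a : ι → ℝ) :
    ∫ y : EuclideanSpace ℝ ι, a ⬝ᵥ y.ofLp ∂multivariateGaussian 0 S = 0 := by
  simpa [EuclideanSpace.inner_eq_star_dotProduct, dotProduct_comm] using
    (innerSL ℝ (WithLp.toLp 2 a)).integral_comp_comm
      (IsGaussian.integrable_id (μ := multivariateGaussian 0 S))

lemma covariance_dotProduct_multivariateGaussian (hS : S.PosSemidef) (a c : ι → ℝ) :
    cov[fun y : EuclideanSpace ℝ ι => a ⬝ᵥ y.ofLp, fun y => c ⬝ᵥ y.ofLp;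
      multivariateGaussian 0 S] = a ⬝ᵥ S *ᵥ c := by
  have h := covarianceBilin_multivariateGaussian (μ := 0) hS (WithLp.toLp 2 a) (WithLp.toLp 2 c)
  rw [covarianceBilin_apply_eq_cov IsGaussian.memLp_two_id] at h
  simpa [EuclideanSpace.inner_eq_star_dotProduct, dotProduct_comm] using h

lemma integral_sq_dotProduct_multivariateGaussian (hS : S.PosSemidef) (a : ι → ℝ) :
    ∫ y : EuclideanSpace ℝ ι, (a ⬝ᵥ y.ofLp) ^ 2 ∂multivariateGaussian 0 S = a ⬝ᵥ S *ᵥ a := by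
  have ha := (memLp_dotProduct_multivariateGaussian (S := S) a).aemeasurable
  rw [← covariance_dotProduct_multivariateGaussian hS, covariance_self ha,
    variance_of_integral_eq_zero ha (integral_dotProduct_multivariateGaussian a)]

lemma indepFun_dotProduct_multivariateGaussian (hS : S.PosSemidef) {κ : Type*} [Finite κ]
    {a : ι → ℝ} {c : κ → ι → ℝ} (h : ∀ j, a ⬝ᵥ S *ᵥ c j = 0) :
    IndepFun (fun y : EuclideanSpace ℝ ι => a ⬝ᵥ y.ofLp) (fun y j => c j ⬝ᵥ y.ofLp)
      (multivariateGaussian 0 S) := by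
  have := Fintype.ofFinite κ
  let L : EuclideanSpace ℝ ι →L[ℝ] (Unit → ℝ) × (κ → ℝ) :=
    (ContinuousLinearMap.pi fun _ => innerSL ℝ (WithLp.toLp 2 a)).prod
      (ContinuousLinearMap.pi fun j => innerSL ℝ (WithLp.toLp 2 (c j)))
  have hL : ∀ y, L y = (fun _ => a ⬝ᵥ y.ofLp, fun j => c j ⬝ᵥ y.ofLp) := fun y => by
    ext <;> simp [L, EuclideanSpace.inner_eq_star_dotProduct, dotProduct_comm]
  have hG := (IsGaussian.hasGaussianLaw_id (μ := multivariateGaussian 0 S)).map_fun L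
  simp only [hL] at hG
  exact (hG.indepFun_of_covariance_eval fun _ j =>
    (covariance_dotProduct_multivariateGaussian hS a (c j)).trans (h j)).comp
      (measurable_pi_apply ()) measurable_id

lemma condExp_add_ae_eq_left_of_indep {Ω : Type*} {m m₀ : MeasurableSpace Ω} {ν : Measure Ω}
    [IsProbabilityMeasure ν] (hm : m ≤ m₀) {f e : Ω → ℝ} (hf : StronglyMeasurable[m] f)
    (hfi : Integrable f ν) (he : Measurable[m₀] e) (hei : Integrable e ν) (hmean : ν[e] = 0)
    (hind : Indep (MeasurableSpace.comap e inferInstance) m ν) : ν[f + e | m] =ᵐ[ν] f := by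
  have hce := condExp_indep_eq he.comap_le hm (comap_measurable e).stronglyMeasurable hind
  have hadd := condExp_add hfi hei m
  rw [condExp_of_stronglyMeasurable hm hf hfi] at hadd
  filter_upwards [hadd, hce] with y h₁ h₂
  rw [h₁, Pi.add_apply, h₂, hmean, add_zero]

lemma condExp_eval_multivariateGaussian (hS : S.PosSemidef) {i : ι} {a : ι → ℝ} (ha : a i = 1)
    (horth : ∀ j ≠ i, (a ᵥ* S) j = 0) :
    condExp (MeasurableSpace.comap
      (fun (y : EuclideanSpace ℝ ι) (j : {j // j ≠ i}) => y j) MeasurableSpace.pi)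
      (multivariateGaussian 0 S) (fun y => y i)
      =ᵐ[multivariateGaussian 0 S] fun y => y i - a ⬝ᵥ y.ofLp := by
  have hind : IndepFun (fun y : EuclideanSpace ℝ ι => a ⬝ᵥ y.ofLp)
      (fun y (j : {j // j ≠ i}) => y j) (multivariateGaussian 0 S) := by
    simpa only [single_one_dotProduct] using indepFun_dotProduct_multivariateGaussian hS (a := a)
      (c := fun j : {j // j ≠ i} => Pi.single j.1 1)
      fun j => by rw [dotProduct_mulVec, dotProduct_single_one, horth j j.2]
  have hint := fun c : ι → ℝ =>
    (memLp_dotProduct_multivariateGaussian (S := S) c).integrable one_le_two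
  have heval : Integrable (fun y : EuclideanSpace ℝ ι => y i) (multivariateGaussian 0 S) := by
    simpa only [single_one_dotProduct] using hint (Pi.single i 1)
  have key := condExp_add_ae_eq_left_of_indep
    (Measurable.comap_le (by fun_prop)) (stronglyMeasurable_sub_dotProduct ha)
    (heval.sub (hint a)) (by unfold dotProduct; fun_prop) (hint a)
    (integral_dotProduct_multivariateGaussian a) hind
  rwa [show (fun y : EuclideanSpace ℝ ι => y i - a ⬝ᵥ y.ofLp) + (fun y => a ⬝ᵥ y.ofLp) =
    fun y => y i from funext fun y => sub_add_cancel _ _] at key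

end GaussianVector

section KrigingError

open Matrix

variable {d n : ℕ} {k k₀ : EuclideanSpace ℝ (Fin d) → ℝ} {s : Fin n → EuclideanSpace ℝ (Fin d)}

lemma sub_krigingPred_ae_eq {b : ℝ} (h : WellConditioned b (covMatrix k s)) (i : Fin n) :
    ∀ᵐ y ∂multivariateGaussian 0 (covMatrix k s),
      y i - krigingPred k s i y = (looMatrix (covMatrix k s)).row i ⬝ᵥ y.ofLp := by
  have horth : ∀ j ≠ i, ((looMatrix (covMatrix k s)).row i ᵥ* covMatrix k s) j = 0 := fun j hj => by
    change (looMatrix (covMatrix k s) * covMatrix k s) i j = 0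
    rw [h.looMatrix_mul, inv_diagonal, diagonal_apply_ne _ hj.symm]
  filter_upwards [condExp_eval_multivariateGaussian h.posDef.posSemidef
    (a := (looMatrix (covMatrix k s)).row i) (h.looMatrix_apply_self i) horth] with y hy
  rw [krigingPred, hy, sub_sub_cancel]

variable {Ω : Type*} [MeasurableSpace Ω] {Y : EuclideanSpace ℝ (Fin d) → Ω → ℝ} {P : Measure Ω}

lemma map_field_eq_multivariateGaussian (hY : IsCenteredGaussianField k Y P)
    (hS : (covMatrix k s).PosSemidef) :
    P.map (fun ω => (WithLp.toLp 2 fun i => Y (s i) ω : EuclideanSpace ℝ (Fin n))) =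
      multivariateGaussian 0 (covMatrix k s) := by
  have hP := hY.gaussian.isProbabilityMeasure
  have hG : HasGaussianLaw
      (fun ω => (WithLp.toLp 2 fun i => Y (s i) ω : EuclideanSpace ℝ (Fin n))) P :=
    ((hY.gaussian.comp_right s).hasGaussianLaw Finset.univ).map_fun
      ((PiLp.continuousLinearEquiv 2 ℝ (fun _ : Fin n => ℝ)).symm.toContinuousLinearMap.comp
        (ContinuousLinearMap.pi fun i => ContinuousLinearMap.proj
          (⟨i, Finset.mem_univ i⟩ : (Finset.univ : Finset (Fin n)))))
  have := hG.isGaussian_map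
  refine IsGaussian.ext ?_ ?_
  · rw [integral_map hG.aemeasurable (by fun_prop)]
    simp only [id_eq, integral_id_multivariateGaussian]
    ext i
    exact ((EuclideanSpace.proj i : EuclideanSpace ℝ (Fin n) →L[ℝ] ℝ).integral_comp_comm
      hG.integrable).symm.trans (hY.centered (s i))
  · ext x y
    rw [covarianceBilin_multivariateGaussian hS, covarianceBilin_apply_pi
      (X := fun i => Y (s i)) fun i => (hY.gaussian.hasGaussianLaw_eval (s i)).memLp_two]
    simp only [hY.covariance, dotProduct, mulVec, covMatrix, Matrix.of_apply, Finset.mul_sum]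
    exact Finset.sum_congr rfl fun i _ => Finset.sum_congr rfl fun j _ => by ring

lemma integral_sum_sq_dotProduct_eq_looForm (hS : (covMatrix k₀ s).PosSemidef)
    (R : Matrix (Fin n) (Fin n) ℝ) :
    ∫ y : EuclideanSpace ℝ (Fin n), ∑ i, ((looMatrix R).row i ⬝ᵥ y.ofLp) ^ 2
      ∂multivariateGaussian 0 (covMatrix k₀ s) = looForm R (covMatrix k₀ s) := by
  rw [integral_finsetSum _ fun i _ => (memLp_dotProduct_multivariateGaussian _).integrable_sq,
    looForm, trace_mul_mul_transpose_eq_sum]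
  simp only [integral_sq_dotProduct_multivariateGaussian hS]

lemma lintegral_sq_sub_krigingPred {b : ℝ} (hY : IsCenteredGaussianField k₀ Y P)
    (h : WellConditioned b (covMatrix k s)) (h₀ : WellConditioned b (covMatrix k₀ s)) :
    ∫⁻ ω, ENNReal.ofReal ((1 / (n : ℝ)) * ∑ i : Fin n, (Y (s i) ω -
        krigingPred k s i (WithLp.toLp 2 fun i => Y (s i) ω)) ^ 2) ∂P =
      ENNReal.ofReal ((1 / (n : ℝ)) * looForm (covMatrix k s) (covMatrix k₀ s)) := by
  have hS := h₀.posDef.posSemidef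
  have hmap := map_field_eq_multivariateGaussian hY hS
  set y : Ω → EuclideanSpace ℝ (Fin n) := fun ω => WithLp.toLp 2 fun i => Y (s i) ω
  have hy : AEMeasurable y P := .of_map_ne_zero (hmap ▸ IsProbabilityMeasure.ne_zero _)
  have hres : ∀ᵐ ω ∂P, ∀ i, y ω i - krigingPred k s i (y ω) =
      (looMatrix (covMatrix k s)).row i ⬝ᵥ (y ω).ofLp := by
    refine ae_of_ae_map (p := fun z : EuclideanSpace ℝ (Fin n) => ∀ i, z i - krigingPred k s i z =
      (looMatrix (covMatrix k s)).row i ⬝ᵥ z.ofLp) hy (hmap ▸ ?_)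
    exact (multivariateGaussian_absolutelyContinuous h.posDef h₀.posDef).ae_le
      (ae_all_iff.2 (sub_krigingPred_ae_eq h))
  calc _ = ∫⁻ ω, ENNReal.ofReal ((1 / (n : ℝ)) *
        ∑ i, ((looMatrix (covMatrix k s)).row i ⬝ᵥ (y ω).ofLp) ^ 2) ∂P := by
        refine lintegral_congr_ae (hres.mono fun ω hω => ?_)
        simp only [← hω]
        rfl
    _ = ∫⁻ z : EuclideanSpace ℝ (Fin n), ENNReal.ofReal ((1 / (n : ℝ)) *
        ∑ i, ((looMatrix (covMatrix k s)).row i ⬝ᵥ z.ofLp) ^ 2)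
          ∂multivariateGaussian 0 (covMatrix k₀ s) := by
        rw [← hmap]
        exact (lintegral_map' (f := fun z : EuclideanSpace ℝ (Fin n) => ENNReal.ofReal
          ((1 / (n : ℝ)) * ∑ i, ((looMatrix (covMatrix k s)).row i ⬝ᵥ z.ofLp) ^ 2))
          (by unfold dotProduct; fun_prop) hy).symm
    _ = _ := by
        rw [← ofReal_integral_eq_lintegral_ofReal
          ((integrable_finsetSum _ fun i _ =>
            (memLp_dotProduct_multivariateGaussian _).integrable_sq).const_mul _)
          (.of_forall fun z => by positivity), integral_const_mul,
          integral_sum_sq_dotProduct_eq_looForm hS]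

end KrigingError

/-! ### Decay, separated points and cosine transforms -/

section Decay

variable {d : ℕ}

/-- The decay profile `1 / (1 + ‖t‖ ^ (d + 1))`, integrable on `ℝ^d` and summable on `ℤ^d`. -/
noncomputable def decay (d : ℕ) (t : EuclideanSpace ℝ (Fin d)) : ℝ := 1 / (1 + ‖t‖ ^ (d + 1))

lemma decay_nonneg (t : EuclideanSpace ℝ (Fin d)) : 0 ≤ decay d t := by
  unfold decay; positivity

lemma decay_le_one (t : EuclideanSpace ℝ (Fin d)) : decay d t ≤ 1 :=
  div_le_one_of_le₀ (le_add_of_nonneg_right (by positivity)) (by positivity)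

lemma decay_le_inv_norm_pow {t : EuclideanSpace ℝ (Fin d)} (ht : t ≠ 0) :
    decay d t ≤ ‖t‖⁻¹ ^ (d + 1) := by
  have := norm_pos_iff.2 ht
  rw [inv_pow, ← one_div, decay]
  gcongr
  linarith

lemma continuous_decay : Continuous (decay d) := by
  unfold decay
  exact continuous_const.div (by fun_prop) fun t => by positivity

lemma integrable_decay : Integrable (decay d) := by
  have h := integrable_one_add_norm (E := EuclideanSpace ℝ (Fin d)) (μ := volume)
    (r := ((d + 1 : ℕ) : ℝ)) (by simp)
  refine (h.const_mul (2 ^ d)).mono' continuous_decay.aestronglyMeasurable (.of_forall fun t => ?_)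
  rw [Real.norm_of_nonneg (decay_nonneg t), Real.rpow_neg (by positivity), Real.rpow_natCast,
    decay, ← div_eq_mul_inv, div_le_div_iff₀ (by positivity) (by positivity), one_mul]
  simpa using add_pow_le zero_le_one (norm_nonneg t) (d + 1)

end Decay

section Lattice

open Matrix

lemma summable_inv_norm_pow_int (d : ℕ) : Summable fun w : Fin d → ℤ => ‖w‖⁻¹ ^ (d + 1) := by
  let L : Submodule ℤ (Fin d → ℝ) := Submodule.span ℤ (Set.range (Pi.basisFun ℝ (Fin d)))
  have hrank : Module.finrank ℤ L = d := by rw [ZLattice.rank ℝ L, Module.finrank_fin_fun]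
  let φ : (Fin d → ℤ) → L := fun w => ⟨fun i => (w i : ℝ), by
    rw [(Pi.basisFun ℝ (Fin d)).mem_span_iff_repr_mem ℤ]
    exact fun i => ⟨w i, by simp⟩⟩
  have hφ : Function.Injective φ := fun w w' hw => funext fun i =>
    Int.cast_injective (α := ℝ) (congrFun (congrArg Subtype.val hw) i)
  have hnorm : ∀ w, ‖φ w‖ = ‖w‖ := fun w => by
    change ‖(fun i => (w i : ℝ))‖ = ‖w‖
    simp [Pi.norm_def, Int.norm_eq_abs, nnnorm]
  simpa only [Function.comp_def, hnorm] using
    (ZLattice.summable_norm_pow_inv L (d + 1) (by omega)).comp_injective hφ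

/-- The sum of `‖w‖ ^ (-(d + 1))` over the nonzero `w ∈ ℤ^d`, for the sup norm; the term `w = 0`
vanishes because `0⁻¹ = 0`. -/
noncomputable def latticeSum (d : ℕ) : ℝ := ∑' w : Fin d → ℤ, ‖w‖⁻¹ ^ (d + 1)

lemma latticeSum_nonneg (d : ℕ) : 0 ≤ latticeSum d := tsum_nonneg fun _ => by positivity

lemma sum_inv_norm_pow_sub_le_latticeSum {d n : ℕ} {v : Fin n → Fin d → ℤ}
    (hv : Function.Injective v) (i : Fin n) :
    ∑ j, ‖v i - v j‖⁻¹ ^ (d + 1) ≤ latticeSum d := by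
  let e : Fin n ↪ (Fin d → ℤ) := ⟨fun j => v i - v j, sub_right_injective.comp hv⟩
  have hmap := Finset.sum_map Finset.univ e fun w => ‖w‖⁻¹ ^ (d + 1)
  exact hmap.ge.trans ((summable_inv_norm_pow_int d).sum_le_tsum _ fun _ _ => by positivity)

lemma abs_form_le_of_sum_abs_le {ι : Type*} [Fintype ι] {M : Matrix ι ι ℝ} {B : ℝ}
    (hrow : ∀ i, ∑ j, |M i j| ≤ B) (hcol : ∀ j, ∑ i, |M i j| ≤ B) (z : ι → ℝ) :
    |z ⬝ᵥ M *ᵥ z| ≤ B * (z ⬝ᵥ z) := by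
  have am_gm : ∀ i j, |z i * (M i j * z j)| ≤
      z i ^ 2 / 2 * |M i j| + z j ^ 2 / 2 * |M i j| := fun i j => by
    rw [mul_left_comm, abs_mul, mul_comm, ← add_mul, abs_mul]
    gcongr
    linarith [two_mul_le_add_sq |z i| |z j|, sq_abs (z i), sq_abs (z j)]
  have row_part : ∑ i, ∑ j, z i ^ 2 / 2 * |M i j| ≤ ∑ i, z i ^ 2 / 2 * B := by
    simp only [← Finset.mul_sum]
    gcongr with i
    exact hrow i
  have col_part : ∑ i, ∑ j, z j ^ 2 / 2 * |M i j| ≤ ∑ i, z i ^ 2 / 2 * B := by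
    rw [Finset.sum_comm]
    simp only [← Finset.mul_sum]
    gcongr with i
    exact hcol i
  calc |z ⬝ᵥ M *ᵥ z| ≤ ∑ i, ∑ j, |z i * (M i j * z j)| := by
        simp only [dotProduct, mulVec, Finset.mul_sum]
        exact (Finset.abs_sum_le_sum_abs _ _).trans
          (Finset.sum_le_sum fun i _ => Finset.abs_sum_le_sum_abs _ _)
    _ ≤ ∑ i, ∑ j, (z i ^ 2 / 2 * |M i j| + z j ^ 2 / 2 * |M i j|) := by
        gcongr with i _ j
        exact am_gm i j
    _ ≤ ∑ i, z i ^ 2 / 2 * B + ∑ i, z i ^ 2 / 2 * B := by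
        simp only [Finset.sum_add_distrib]
        exact add_le_add row_part col_part
    _ = B * (z ⬝ᵥ z) := by
        rw [← Finset.sum_add_distrib, dotProduct, Finset.mul_sum]
        exact Finset.sum_congr rfl fun i _ => by ring

/-- The points `s i` are indexed by distinct lattice points, whose distances they respect up to the
factor `c`. -/
def IsLatticeSeparated {d n : ℕ} (c : ℝ) (s : Fin n → EuclideanSpace ℝ (Fin d)) : Prop :=
  ∃ v : Fin n → Fin d → ℤ, Function.Injective v ∧ ∀ i j, c * ‖v i - v j‖ ≤ ‖s i - s j‖

lemma IsLatticeSeparated.abs_form_sub_le {d n : ℕ} {c C : ℝ} {s : Fin n → EuclideanSpace ℝ (Fin d)}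
    (hs : IsLatticeSeparated c s) (hc : 0 < c) (hC : 0 ≤ C) {h : EuclideanSpace ℝ (Fin d) → ℝ}
    (hh : ∀ t, t ≠ 0 → |h t| ≤ C * ‖t‖⁻¹ ^ (d + 1)) (z : Fin n → ℝ) :
    |z ⬝ᵥ covMatrix h s *ᵥ z - h 0 * (z ⬝ᵥ z)| ≤
      C * c⁻¹ ^ (d + 1) * latticeSum d * (z ⬝ᵥ z) := by
  obtain ⟨v, hv, hvs⟩ := hs
  have hentry : ∀ i j, |(covMatrix h s - h 0 • 1) i j| ≤
      C * c⁻¹ ^ (d + 1) * ‖v i - v j‖⁻¹ ^ (d + 1) := fun i j => by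
    rcases eq_or_ne i j with rfl | hij
    · simp [covMatrix]
    have hpos : 0 < c * ‖v i - v j‖ := mul_pos hc (norm_pos_iff.2 (sub_ne_zero.2 (hv.ne hij)))
    calc |(covMatrix h s - h 0 • 1) i j| = |h (s i - s j)| := by simp [covMatrix, hij]
      _ ≤ C * ‖s i - s j‖⁻¹ ^ (d + 1) := hh _ (norm_pos_iff.1 (hpos.trans_le (hvs i j)))
      _ ≤ C * (c * ‖v i - v j‖)⁻¹ ^ (d + 1) := by gcongr; exact hvs i j
      _ = C * c⁻¹ ^ (d + 1) * ‖v i - v j‖⁻¹ ^ (d + 1) := by rw [mul_inv, mul_pow, mul_assoc]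
  have hrow : ∀ i, ∑ j, |(covMatrix h s - h 0 • 1) i j| ≤ C * c⁻¹ ^ (d + 1) * latticeSum d :=
    fun i => (Finset.sum_le_sum fun j _ => hentry i j).trans <| by
      grw [← Finset.mul_sum, sum_inv_norm_pow_sub_le_latticeSum hv i]
  have hcol : ∀ j, ∑ i, |(covMatrix h s - h 0 • 1) i j| ≤ C * c⁻¹ ^ (d + 1) * latticeSum d :=
    fun j => (Finset.sum_le_sum fun i _ => hentry i j).trans <| by
      simp only [norm_sub_rev _ (v j)]
      grw [← Finset.mul_sum, sum_inv_norm_pow_sub_le_latticeSum hv j]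
  simpa only [sub_mulVec, smul_mulVec, one_mulVec, dotProduct_sub, dotProduct_smul, smul_eq_mul]
    using abs_form_le_of_sum_abs_le hrow hcol z

end Lattice

section CosTransform

open Matrix

variable {d n : ℕ} {g : EuclideanSpace ℝ (Fin d) → ℝ}

/-- The cosine transform `t ↦ ∫ g(f) cos(f·t) df`, which is the Fourier transform of an even `g`
with the normalization under which a covariance function is the transform of its spectral
density. -/
noncomputable def cosTransform (g : EuclideanSpace ℝ (Fin d) → ℝ) (t : EuclideanSpace ℝ (Fin d)) :
    ℝ :=
  ∫ f, g f * Real.cos (inner ℝ f t)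

lemma cosTransform_zero : cosTransform g 0 = ∫ f, g f := by simp [cosTransform]

lemma cosTransform_neg (t : EuclideanSpace ℝ (Fin d)) : cosTransform g (-t) = cosTransform g t := by
  simp [cosTransform]

lemma integrable_mul_cos (hg : Integrable g) (t : EuclideanSpace ℝ (Fin d)) :
    Integrable fun f => g f * Real.cos (inner ℝ f t) :=
  hg.mul_bdd (c := 1) (by fun_prop) (.of_forall fun _ => Real.abs_cos_le_one _)

lemma continuous_cosTransform (hg : Integrable g) : Continuous (cosTransform g) := by
  refine continuous_of_dominated (bound := fun f => ‖g f‖)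
    (fun t => (integrable_mul_cos hg t).aestronglyMeasurable)
    (fun t => .of_forall fun f => ?_) hg.norm (.of_forall fun f => by fun_prop)
  rw [norm_mul]
  exact mul_le_of_le_one_right (norm_nonneg _) (Real.abs_cos_le_one _)

lemma cosTransform_eq_re_fourier (hg : Integrable g) (t : EuclideanSpace ℝ (Fin d)) :
    cosTransform g t =
      (FourierTransform.fourier (fun f => (g f : ℂ)) ((2 * Real.pi)⁻¹ • t)).re := by
  have hint : Integrable fun f : EuclideanSpace ℝ (Fin d) =>
      Complex.exp (((-inner ℝ f t : ℝ) : ℂ) * Complex.I) * (g f : ℂ) :=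
    hg.ofReal.bdd_mul (c := 1) (by fun_prop)
      (.of_forall fun f => (Complex.norm_exp_ofReal_mul_I _).le)
  have hphase : ∀ f : EuclideanSpace ℝ (Fin d),
      -2 * Real.pi * inner ℝ f ((2 * Real.pi)⁻¹ • t) = -inner ℝ f t := fun f => by
    rw [inner_smul_right]
    field_simp
  simp only [Real.fourier_eq', hphase, smul_eq_mul]
  refine Eq.trans (integral_congr_ae (.of_forall fun f => ?_)) (integral_re hint)
  change _ = Complex.re _
  rw [Complex.re_mul_ofReal, Complex.exp_ofReal_mul_I_re, Real.cos_neg, mul_comm]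

lemma exists_norm_pow_mul_abs_cosTransform_le (hsm : ContDiff ℝ (⊤ : ℕ∞) g)
    (hcs : HasCompactSupport g) (m : ℕ) :
    ∃ C, 0 ≤ C ∧ ∀ t, ‖t‖ ^ m * |cosTransform g t| ≤ C := by
  let Ψ : SchwartzMap (EuclideanSpace ℝ (Fin d)) ℂ :=
    (hcs.comp_left (g := fun x : ℝ => (x : ℂ)) Complex.ofReal_zero).toSchwartzMap
      (Complex.ofRealCLM.contDiff.comp hsm)
  obtain ⟨C, hC, hdec⟩ := (FourierTransform.fourier Ψ).decay m 0
  refine ⟨(2 * Real.pi) ^ m * C, by positivity, fun t => ?_⟩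
  have h := hdec ((2 * Real.pi)⁻¹ • t)
  rw [norm_iteratedFDeriv_zero, norm_smul, norm_inv, Real.norm_of_nonneg (by positivity), mul_pow,
    inv_pow, mul_assoc, inv_mul_le_iff₀ (by positivity), SchwartzMap.fourier_coe] at h
  rw [cosTransform_eq_re_fourier (hsm.continuous.integrable_of_hasCompactSupport hcs)]
  exact (mul_le_mul_of_nonneg_left (Complex.abs_re_le_norm _) (by positivity)).trans h

lemma cosTransform_comp_inv_smul {M : ℝ} (hM : 0 < M) (t : EuclideanSpace ℝ (Fin d)) :
    cosTransform (fun f => g (M⁻¹ • f)) t = M ^ d * cosTransform g (M • t) := by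
  have h := Measure.integral_comp_inv_smul volume
    (fun f : EuclideanSpace ℝ (Fin d) => g f * Real.cos (inner ℝ f (M • t))) M
  simpa only [cosTransform, real_inner_smul_left, real_inner_smul_right,
    mul_inv_cancel_left₀ hM.ne', finrank_euclideanSpace_fin, smul_eq_mul,
    abs_of_pos (pow_pos hM d)] using h

lemma dotProduct_covMatrix_mulVec (h : EuclideanSpace ℝ (Fin d) → ℝ)
    (s : Fin n → EuclideanSpace ℝ (Fin d)) (z : Fin n → ℝ) :
    z ⬝ᵥ covMatrix h s *ᵥ z = ∑ i, ∑ j, z i * z j * h (s i - s j) := by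
  simp only [dotProduct, mulVec, covMatrix, of_apply, Finset.mul_sum]
  exact Finset.sum_congr rfl fun i _ => Finset.sum_congr rfl fun j _ => by ring

lemma form_cos_nonneg (s : Fin n → EuclideanSpace ℝ (Fin d)) (z : Fin n → ℝ)
    (f : EuclideanSpace ℝ (Fin d)) :
    0 ≤ z ⬝ᵥ covMatrix (fun t => Real.cos (inner ℝ f t)) s *ᵥ z := by
  set C : Fin n → ℝ := fun i => Real.cos (inner ℝ f (s i))
  set S : Fin n → ℝ := fun i => Real.sin (inner ℝ f (s i))
  have hsplit : covMatrix (fun t => Real.cos (inner ℝ f t)) s = vecMulVec C C + vecMulVec S S := by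
    ext i j
    simp [covMatrix, vecMulVec_apply, C, S, inner_sub_right, Real.cos_sub]
  rw [hsplit, add_mulVec, dotProduct_add, vecMulVec_mulVec, vecMulVec_mulVec]
  simp only [op_smul_eq_smul, dotProduct_smul, smul_eq_mul, dotProduct_comm C z,
    dotProduct_comm S z]
  exact add_nonneg (mul_self_nonneg _) (mul_self_nonneg _)

lemma mul_form_cos_eq_sum (s : Fin n → EuclideanSpace ℝ (Fin d)) (z : Fin n → ℝ)
    (f : EuclideanSpace ℝ (Fin d)) :
    g f * (z ⬝ᵥ covMatrix (fun t => Real.cos (inner ℝ f t)) s *ᵥ z) =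
      ∑ i, ∑ j, z i * z j * (g f * Real.cos (inner ℝ f (s i - s j))) := by
  simp only [dotProduct_covMatrix_mulVec, Finset.mul_sum, mul_left_comm (g f)]

lemma integrable_mul_form_cos (hg : Integrable g) (s : Fin n → EuclideanSpace ℝ (Fin d))
    (z : Fin n → ℝ) :
    Integrable fun f => g f * (z ⬝ᵥ covMatrix (fun t => Real.cos (inner ℝ f t)) s *ᵥ z) := by
  simp only [mul_form_cos_eq_sum]
  exact integrable_finsetSum _ fun i _ => integrable_finsetSum _ fun j _ =>
    (integrable_mul_cos hg _).const_mul _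

lemma form_cosTransform (hg : Integrable g) (s : Fin n → EuclideanSpace ℝ (Fin d))
    (z : Fin n → ℝ) :
    z ⬝ᵥ covMatrix (cosTransform g) s *ᵥ z =
      ∫ f, g f * (z ⬝ᵥ covMatrix (fun t => Real.cos (inner ℝ f t)) s *ᵥ z) := by
  have hint := fun i j => (integrable_mul_cos hg (s i - s j)).const_mul (z i * z j)
  simp only [mul_form_cos_eq_sum]
  rw [integral_finsetSum _ fun i _ => integrable_finsetSum _ fun j _ => hint i j,
    dotProduct_covMatrix_mulVec]
  refine Finset.sum_congr rfl fun i _ => ?_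
  rw [integral_finsetSum _ fun j _ => hint i j]
  exact Finset.sum_congr rfl fun j _ => (integral_const_mul _ _).symm

lemma mul_form_cosTransform_le {g₁ g₂ : EuclideanSpace ℝ (Fin d) → ℝ} (h₁ : Integrable g₁)
    (h₂ : Integrable g₂) {m : ℝ} (hle : ∀ f, m * g₁ f ≤ g₂ f)
    (s : Fin n → EuclideanSpace ℝ (Fin d)) (z : Fin n → ℝ) :
    m * (z ⬝ᵥ covMatrix (cosTransform g₁) s *ᵥ z) ≤ z ⬝ᵥ covMatrix (cosTransform g₂) s *ᵥ z := by
  rw [form_cosTransform h₁, form_cosTransform h₂, ← integral_const_mul]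
  refine integral_mono ((integrable_mul_form_cos h₁ s z).const_mul m)
    (integrable_mul_form_cos h₂ s z) fun f => ?_
  simpa only [← mul_assoc] using mul_le_mul_of_nonneg_right (hle f) (form_cos_nonneg s z f)

/-- Dilating the density by `M` multiplies the diagonal of the covariance matrix by `M ^ d`, but its
off-diagonal part only by `M ^ d / M ^ (d + 1)`. -/
lemma exists_le_form_cosTransform_dilation (hsm : ContDiff ℝ (⊤ : ℕ∞) g)
    (hcs : HasCompactSupport g) (hpos : 0 < ∫ f, g f) {c : ℝ} (hc : 0 < c) :
    ∃ M a : ℝ, 0 < M ∧ 0 < a ∧ ∀ (n : ℕ) (s : Fin n → EuclideanSpace ℝ (Fin d)),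
      IsLatticeSeparated c s → ∀ z : Fin n → ℝ,
        a * (z ⬝ᵥ z) ≤ z ⬝ᵥ covMatrix (cosTransform fun f => g (M⁻¹ • f)) s *ᵥ z := by
  obtain ⟨C, hC, hdec⟩ := exists_norm_pow_mul_abs_cosTransform_le hsm hcs (d + 1)
  set I₀ := ∫ f, g f
  set Λ := c⁻¹ ^ (d + 1) * latticeSum d
  have hΛ : 0 ≤ Λ := mul_nonneg (by positivity) (latticeSum_nonneg d)
  set M : ℝ := 2 * (C * Λ) / I₀ + 1
  have hM : 0 < M := by positivity
  have hdiag : I₀ ≤ cosTransform (fun f => g (M⁻¹ • f)) 0 := by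
    rw [cosTransform_comp_inv_smul hM, smul_zero, cosTransform_zero]
    exact le_mul_of_one_le_left hpos.le (one_le_pow₀ (le_add_of_nonneg_left (by positivity)))
  have hoff : C / M * Λ ≤ I₀ / 2 := by
    rw [div_mul_eq_mul_div, div_le_iff₀ hM]
    simp only [M]
    field_simp
    linarith
  have hdecM : ∀ t, t ≠ 0 → |cosTransform (fun f => g (M⁻¹ • f)) t| ≤ C / M * ‖t‖⁻¹ ^ (d + 1) :=
    fun t ht => by
      have := norm_pos_iff.2 ht
      have h := hdec (M • t)
      rw [norm_smul, Real.norm_of_nonneg hM.le, mul_pow, pow_succ M] at h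
      rw [cosTransform_comp_inv_smul hM, abs_mul, abs_of_pos (pow_pos hM d), inv_pow,
        ← div_eq_mul_inv, div_div, le_div_iff₀ (by positivity)]
      linarith
  refine ⟨M, I₀ / 2, hM, by positivity, fun n s hs z => ?_⟩
  have hz := dotProduct_self_nonneg z
  have hform := abs_le.1 (hs.abs_form_sub_le hc (by positivity) hdecM z)
  rw [mul_assoc (C / M)] at hform
  nlinarith [mul_le_mul_of_nonneg_right hdiag hz, mul_le_mul_of_nonneg_right hoff hz]

end CosTransform

/-! ### Spectral families -/

section Scheffe

lemma tendsto_integral_abs_sub_zero {α ι : Type*} [MeasurableSpace α] {μ : Measure α} {l : Filter ι}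
    [l.IsCountablyGenerated] {F : ι → α → ℝ} {f : α → ℝ} (hF : ∀ᶠ i in l, Integrable (F i) μ)
    (hF_nonneg : ∀ᶠ i in l, ∀ x, 0 ≤ F i x) (hf : Integrable f μ)
    (hlim : ∀ x, Tendsto (fun i => F i x) l (𝓝 (f x)))
    (hint : Tendsto (fun i => ∫ x, F i x ∂μ) l (𝓝 (∫ x, f x ∂μ))) :
    Tendsto (fun i => ∫ x, |F i x - f x| ∂μ) l (𝓝 0) := by
  have hpos : Tendsto (fun i => ∫ x, max (f x - F i x) 0 ∂μ) l (𝓝 (∫ _, 0 ∂μ)) := by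
    refine tendsto_integral_filter_of_dominated_convergence (fun x => |f x|) ?_ ?_ hf.abs
      (.of_forall fun x => ?_)
    · filter_upwards [hF] with i hi using (hf.sub hi).pos_part.aestronglyMeasurable
    · filter_upwards [hF_nonneg] with i hi
      refine .of_forall fun x => ?_
      rw [Real.norm_of_nonneg (le_max_right _ _)]
      exact max_le (by linarith [hi x, le_abs_self (f x)]) (abs_nonneg _)
    · simpa using ((hlim x).const_sub (f x)).max (tendsto_const_nhds (x := 0))
  have hsplit : ∀ᶠ i in l, ∫ x, |F i x - f x| ∂μ =
      (∫ x, F i x ∂μ - ∫ x, f x ∂μ) + 2 * ∫ x, max (f x - F i x) 0 ∂μ := by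
    filter_upwards [hF] with i hi
    rw [← integral_sub hi hf, ← integral_const_mul]
    refine Eq.trans (integral_congr_ae (.of_forall fun x => ?_))
      (integral_add (hi.sub hf) ((hf.sub hi).pos_part.const_mul 2))
    rcases le_total (f x) (F i x) with h | h
    · simp [abs_of_nonneg (sub_nonneg.2 h), h]
    · simp only [abs_of_nonpos (sub_nonpos.2 h), max_eq_left (sub_nonneg.2 h)]
      ring
  refine (tendsto_congr' hsplit).2 ?_
  simpa using (hint.sub_const (∫ x, f x ∂μ)).add (hpos.const_mul 2)

end Scheffe

section SpectralFamily

open Matrix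

variable {d : ℕ} {T : Type*} [TopologicalSpace T] {S : Set T}
  {k g : T → EuclideanSpace ℝ (Fin d) → ℝ}

/-- `k τ`, for `τ ∈ S`, are correlation functions which decay uniformly in `τ` and have positive
spectral densities `g τ`, continuous jointly in the frequency and `τ`. -/
structure IsSpectralFamily (S : Set T) (k g : T → EuclideanSpace ℝ (Fin d) → ℝ) : Prop where
  exists_abs_le : ∃ C, 0 ≤ C ∧ ∀ τ ∈ S, ∀ t, |k τ t| ≤ C * decay d t
  apply_zero : ∀ τ ∈ S, k τ 0 = 1
  eq_cosTransform : ∀ τ ∈ S, k τ = cosTransform (g τ)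
  integrable : ∀ τ ∈ S, Integrable (g τ)
  pos : ∀ τ ∈ S, ∀ f, 0 < g τ f
  continuousOn :
    ContinuousOn (fun q : EuclideanSpace ℝ (Fin d) × T => g q.2 q.1) (Set.univ ×ˢ S)

namespace IsSpectralFamily

lemma continuous (h : IsSpectralFamily S k g) {τ : T} (hτ : τ ∈ S) : Continuous (k τ) :=
  h.eq_cosTransform τ hτ ▸ continuous_cosTransform (h.integrable τ hτ)

lemma integral_eq_one (h : IsSpectralFamily S k g) {τ : T} (hτ : τ ∈ S) : ∫ f, g τ f = 1 := by
  rw [← cosTransform_zero, ← h.eq_cosTransform τ hτ, h.apply_zero τ hτ]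

lemma continuousOn_apply [FirstCountableTopology T] (h : IsSpectralFamily S k g)
    (t : EuclideanSpace ℝ (Fin d)) : ContinuousOn (fun τ => k τ t) S := fun τ₀ hτ₀ => by
  have hdensity : Tendsto (fun τ => ∫ f, |g τ f - g τ₀ f|) (𝓝[S] τ₀) (𝓝 0) := by
    refine tendsto_integral_abs_sub_zero ?_ ?_ (h.integrable τ₀ hτ₀) (fun f => ?_) ?_
    · filter_upwards [self_mem_nhdsWithin] with τ hτ using h.integrable τ hτ
    · filter_upwards [self_mem_nhdsWithin] with τ hτ f using (h.pos τ hτ f).le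
    · exact (h.continuousOn.comp (continuousOn_const.prodMk continuousOn_id)
        fun τ hτ => ⟨Set.mem_univ f, hτ⟩) τ₀ hτ₀
    · rw [h.integral_eq_one hτ₀]
      refine tendsto_const_nhds.congr' ?_
      filter_upwards [self_mem_nhdsWithin] with τ hτ using (h.integral_eq_one hτ).symm
  refine tendsto_iff_dist_tendsto_zero.2
    (squeeze_zero' (.of_forall fun _ => dist_nonneg) ?_ hdensity)
  filter_upwards [self_mem_nhdsWithin] with τ hτ
  have hi := h.integrable τ hτ
  have hi₀ := h.integrable τ₀ hτ₀
  rw [Real.dist_eq, h.eq_cosTransform τ hτ, h.eq_cosTransform τ₀ hτ₀, cosTransform, cosTransform,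
    ← integral_sub (integrable_mul_cos hi t) (integrable_mul_cos hi₀ t)]
  refine abs_integral_le_integral_abs.trans (integral_mono_of_nonneg
    (.of_forall fun _ => abs_nonneg _) (hi.sub hi₀).abs (.of_forall fun f => ?_))
  simp only [← sub_mul, abs_mul]
  exact mul_le_of_le_one_right (abs_nonneg _) (Real.abs_cos_le_one _)

lemma exists_mul_le_of_compact_support (h : IsSpectralFamily S k g) (hS : IsCompact S)
    {χ : EuclideanSpace ℝ (Fin d) → ℝ} {r : ℝ} (hχ_le : ∀ f, χ f ≤ 1)
    (hχ_zero : ∀ f, r ≤ ‖f‖ → χ f = 0) :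
    ∃ m, 0 < m ∧ ∀ τ ∈ S, ∀ f, m * χ f ≤ g τ f := by
  obtain ⟨m, hm, hmin⟩ :=
    ((isCompact_closedBall (0 : EuclideanSpace ℝ (Fin d)) r).prod hS).exists_forall_le'
      (h.continuousOn.mono (Set.prod_mono (Set.subset_univ _) subset_rfl)) (a := 0)
      fun q hq => h.pos q.2 hq.2 q.1
  refine ⟨m, hm, fun τ hτ f => ?_⟩
  rcases le_total r ‖f‖ with hf | hf
  · simpa [hχ_zero f hf] using (h.pos τ hτ f).le
  · exact (mul_le_of_le_one_right hm.le (hχ_le f)).trans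
      (hmin (f, τ) ⟨mem_closedBall_zero_iff.2 hf, hτ⟩)

lemma exists_le_form (h : IsSpectralFamily S k g) (hS : IsCompact S) {c : ℝ} (hc : 0 < c) :
    ∃ a, 0 < a ∧ ∀ τ ∈ S, ∀ (n : ℕ) (s : Fin n → EuclideanSpace ℝ (Fin d)),
      IsLatticeSeparated c s → ∀ z : Fin n → ℝ, a * (z ⬝ᵥ z) ≤ z ⬝ᵥ covMatrix (k τ) s *ᵥ z := by
  let χ : ContDiffBump (0 : EuclideanSpace ℝ (Fin d)) := ⟨1, 2, one_pos, one_lt_two⟩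
  obtain ⟨M, a, hM, ha, hform⟩ :=
    exists_le_form_cosTransform_dilation χ.contDiff χ.hasCompactSupport χ.integral_pos hc
  obtain ⟨m, hm, hmle⟩ := h.exists_mul_le_of_compact_support hS (χ := fun f => χ (M⁻¹ • f))
    (r := 2 * M) (fun _ => χ.le_one) fun f hf => χ.zero_of_le_dist <| by
      rw [dist_zero_right, norm_smul, norm_inv, Real.norm_of_nonneg hM.le, inv_mul_eq_div]
      exact (le_div_iff₀ hM).2 hf
  have hχ_int : Integrable fun f => χ (M⁻¹ • f) := χ.integrable.comp_smul (inv_ne_zero hM.ne')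
  refine ⟨m * a, by positivity, fun τ hτ n s hs z => ?_⟩
  rw [mul_assoc, h.eq_cosTransform τ hτ]
  exact (mul_le_mul_of_nonneg_left (hform n s hs z) hm.le).trans
    (mul_form_cosTransform_le hχ_int (h.integrable τ hτ) (hmle τ hτ) s z)

lemma exists_form_le (h : IsSpectralFamily S k g) {c : ℝ} (hc : 0 < c) :
    ∃ b, ∀ τ ∈ S, ∀ (n : ℕ) (s : Fin n → EuclideanSpace ℝ (Fin d)),
      IsLatticeSeparated c s → ∀ z : Fin n → ℝ, z ⬝ᵥ covMatrix (k τ) s *ᵥ z ≤ b * (z ⬝ᵥ z) := by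
  obtain ⟨C, hC, hle⟩ := h.exists_abs_le
  refine ⟨1 + C * c⁻¹ ^ (d + 1) * latticeSum d, fun τ hτ n s hs z => ?_⟩
  have hschur := (abs_le.1 (hs.abs_form_sub_le hc hC (fun t ht => (hle τ hτ t).trans
    (mul_le_mul_of_nonneg_left (decay_le_inv_norm_pow ht) hC)) z)).2
  rw [h.apply_zero τ hτ] at hschur
  linarith

theorem exists_wellConditioned (h : IsSpectralFamily S k g) (hS : IsCompact S) {c : ℝ}
    (hc : 0 < c) :
    ∃ b, ∀ τ ∈ S, ∀ (n : ℕ) (s : Fin n → EuclideanSpace ℝ (Fin d)),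
      IsLatticeSeparated c s → WellConditioned b (covMatrix (k τ) s) := by
  obtain ⟨a, ha, hlower⟩ := h.exists_le_form hS hc
  obtain ⟨b, hupper⟩ := h.exists_form_le hc
  refine ⟨max 1 (max a⁻¹ b), fun τ hτ n s hs => ⟨le_max_left _ _, ?_, fun z => ?_, fun z => ?_⟩⟩
  · ext i j
    simp only [transpose_apply, covMatrix, of_apply, h.eq_cosTransform τ hτ]
    rw [← cosTransform_neg, neg_sub]
  · refine (mul_le_mul_of_nonneg_right ?_ (dotProduct_self_nonneg z)).trans (hlower τ hτ n s hs z)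
    exact inv_le_of_inv_le₀ ha ((le_max_left _ _).trans (le_max_right _ _))
  · exact (hupper τ hτ n s hs z).trans (mul_le_mul_of_nonneg_right
      ((le_max_right _ _).trans (le_max_right _ _)) (dotProduct_self_nonneg z))

lemma exists_sq_sub_le (h : IsSpectralFamily S k g) :
    ∃ C, ∀ τ ∈ S, ∀ τ₀ ∈ S, ∀ t, (k τ t - k τ₀ t) ^ 2 ≤ C * decay d t := by
  obtain ⟨C, _, hle⟩ := h.exists_abs_le
  refine ⟨(2 * C) ^ 2, fun τ hτ τ₀ hτ₀ t => ?_⟩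
  have hdecay := decay_nonneg t
  have habs : |k τ t - k τ₀ t| ≤ 2 * C * decay d t := by
    linarith [abs_sub (k τ t) (k τ₀ t), hle τ hτ t, hle τ₀ hτ₀ t]
  calc (k τ t - k τ₀ t) ^ 2 ≤ (2 * C * decay d t) ^ 2 :=
        sq_le_sq.2 (habs.trans (le_abs_self _))
    _ = (2 * C) ^ 2 * (decay d t * decay d t) := by ring
    _ ≤ (2 * C) ^ 2 * decay d t := by
        gcongr
        exact mul_le_of_le_one_left hdecay (decay_le_one t)

variable {Q : Measure (EuclideanSpace ℝ (Fin d))} {τ₀ : T}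

lemma integrable_sq_sub (h : IsSpectralFamily S k g) {τ : T} (hτ : τ ∈ S) (hτ₀ : τ₀ ∈ S)
    (hQ : Integrable (decay d) Q) : Integrable (fun t => (k τ t - k τ₀ t) ^ 2) Q := by
  obtain ⟨C, hle⟩ := h.exists_sq_sub_le
  refine (hQ.const_mul C).mono'
    (((h.continuous hτ).sub (h.continuous hτ₀)).pow 2).aestronglyMeasurable
    (.of_forall fun t => ?_)
  rw [Real.norm_of_nonneg (sq_nonneg _)]
  exact hle τ hτ τ₀ hτ₀ t

lemma continuousOn_integral_sq_sub [FirstCountableTopology T] (h : IsSpectralFamily S k g)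
    (hτ₀ : τ₀ ∈ S) (hQ : Integrable (decay d) Q) :
    ContinuousOn (fun τ => ∫ t, (k τ t - k τ₀ t) ^ 2 ∂Q) S := by
  obtain ⟨C, hle⟩ := h.exists_sq_sub_le
  refine continuousOn_of_dominated
    (fun τ hτ => (h.integrable_sq_sub hτ hτ₀ hQ).aestronglyMeasurable)
    (fun τ hτ => .of_forall fun t => ?_) (hQ.const_mul C)
    (.of_forall fun t => ((h.continuousOn_apply t).sub continuousOn_const).pow 2)
  rw [Real.norm_of_nonneg (sq_nonneg _)]
  exact hle τ hτ τ₀ hτ₀ t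

end IsSpectralFamily

end SpectralFamily

/-! ### Grid averages -/

section Grid

variable {d : ℕ} {v : ℕ → Fin d → ℤ}

/-- The average over `i < n` of `∑ j < n, G (v i - v j)`: the mean interaction of a point of the
grid with the others. -/
noncomputable def gridAverage (v : ℕ → Fin d → ℤ) (G : (Fin d → ℤ) → ℝ≥0∞) (n : ℕ) : ℝ≥0∞ :=
  (n : ℝ≥0∞)⁻¹ * ∑ i : Fin n, ∑ j : Fin n, G (v i - v j)

lemma card_intCube (a b : ℤ) :
    (Fintype.piFinset fun _ : Fin d => Finset.Icc a b).card = (b + 1 - a).toNat ^ d := by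
  simp only [Fintype.card_piFinset, Int.card_Icc, Finset.prod_const, Finset.card_univ,
    Fintype.card_fin]

lemma IsGridEnumeration.image_eq (hv : IsGridEnumeration v) {N : ℕ} (hN : 1 ≤ N) :
    (Finset.range (N ^ d)).image v = Fintype.piFinset fun _ => Finset.Icc 1 (N : ℤ) := by
  ext u
  simpa [Fintype.mem_piFinset] using Set.ext_iff.1 (hv N hN) u

lemma IsGridEnumeration.exists_fin_eq (hv : IsGridEnumeration v) {N n : ℕ} (hN : 1 ≤ N)
    (hn : N ^ d ≤ n) {u : Fin d → ℤ} (hu : ∀ k, u k ∈ Finset.Icc 1 (N : ℤ)) :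
    ∃ j : Fin n, v j = u := by
  have hmem := Fintype.mem_piFinset.2 hu
  rw [← hv.image_eq hN, Finset.mem_image] at hmem
  obtain ⟨j, hj, rfl⟩ := hmem
  exact ⟨⟨j, (Finset.mem_range.1 hj).trans_le hn⟩, rfl⟩

lemma IsGridEnumeration.injective (hv : IsGridEnumeration v) (hd : 0 < d) :
    Function.Injective v := by
  intro i j hij
  set N := max i j + 1
  have hle : N ≤ N ^ d := Nat.le_self_pow hd.ne' N
  have hcard : ((Finset.range (N ^ d)).image v).card = (Finset.range (N ^ d)).card := by
    rw [hv.image_eq (by omega), card_intCube, Finset.card_range, add_sub_cancel_right,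
      Int.toNat_natCast]
  have hinj := Finset.card_image_iff.1 hcard
  refine hinj ?_ ?_ hij <;> simp only [Finset.coe_range, Set.mem_Iio] <;> omega

lemma sum_comp_le_tsum {n : ℕ} {w : Fin n → Fin d → ℤ} (hw : Function.Injective w)
    (G : (Fin d → ℤ) → ℝ≥0∞) : ∑ j, G (w j) ≤ ∑' u, G u :=
  (tsum_fintype (L := .unconditional _) _).ge.trans
    (ENNReal.tsum_comp_le_tsum_of_injective hw G)

lemma gridAverage_le_tsum (hv : Function.Injective v) (G : (Fin d → ℤ) → ℝ≥0∞) (n : ℕ) :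
    gridAverage v G n ≤ ∑' w, G w := by
  have hrow (i : Fin n) : ∑ j : Fin n, G (v i - v j) ≤ ∑' w, G w :=
    sum_comp_le_tsum (fun _ _ h => Fin.ext (hv (sub_right_injective h))) G
  calc gridAverage v G n ≤ (n : ℝ≥0∞)⁻¹ * (n * ∑' w, G w) := by
        unfold gridAverage
        grw [Finset.sum_le_card_nsmul _ _ _ fun i _ => hrow i]
        simp
    _ ≤ 1 * ∑' w, G w := by
        rw [← mul_assoc]
        grw [ENNReal.inv_mul_le_one]
    _ = ∑' w, G w := one_mul _

lemma IsGridEnumeration.sum_le_sum_sub (hv : IsGridEnumeration v) {N n M : ℕ} (hN : 1 ≤ N)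
    (hn : N ^ d ≤ n) {F : Finset (Fin d → ℤ)} (hF : ∀ w ∈ F, ∀ k, |w k| ≤ M) {i : ℕ}
    (hi : ∀ k, v i k ∈ Finset.Icc (1 + M : ℤ) (N - M)) (G : (Fin d → ℤ) → ℝ≥0∞) :
    ∑ w ∈ F, G w ≤ ∑ j : Fin n, G (v i - v j) := by
  have hmem (w : F) : ∃ j : Fin n, v j = v i - w := by
    refine hv.exists_fin_eq hN hn fun k => ?_
    have h₁ := Finset.mem_Icc.1 (hi k)
    have h₂ := abs_le.1 (hF w w.2 k)
    rw [Finset.mem_Icc, Pi.sub_apply]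
    omega
  choose j hj using hmem
  have hj_inj : Function.Injective j := fun w w' h => by
    have := congrArg (fun a : Fin n => v a) h
    rw [hj, hj] at this
    exact Subtype.ext (sub_right_injective this)
  calc ∑ w ∈ F, G w = ∑ w : F, G (v i - v (j w)) := by
        rw [← Finset.sum_coe_sort]
        simp only [hj, sub_sub_cancel]
    _ ≤ ∑ a : Fin n, G (v i - v a) := by
        rw [← Finset.sum_image (f := fun a : Fin n => G (v i - v a)) hj_inj.injOn]
        exact Finset.sum_le_sum_of_subset (Finset.subset_univ _)

lemma IsGridEnumeration.le_card_interior (hv : IsGridEnumeration v) {N n M : ℕ} (hM : 4 * M < N)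
    (hn : N ^ d ≤ n) (hn' : n < (N + 1) ^ d) :
    n ≤ 2 ^ d * {i : Fin n | ∀ k, v i k ∈ Finset.Icc (1 + M : ℤ) (N - M)}.toFinset.card := by
  set I := {i : Fin n | ∀ k, v i k ∈ Finset.Icc (1 + M : ℤ) (N - M)}.toFinset
  have hsub : (Fintype.piFinset fun _ : Fin d => Finset.Icc (1 + M : ℤ) (N - M)) ⊆
      I.image fun i : Fin n => v i := by
    intro u hu
    rw [Fintype.mem_piFinset] at hu
    obtain ⟨j, rfl⟩ := hv.exists_fin_eq (u := u) (by omega) hn fun k => by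
      have := Finset.mem_Icc.1 (hu k)
      rw [Finset.mem_Icc]
      omega
    exact Finset.mem_image_of_mem _ (Set.mem_toFinset.2 hu)
  calc n ≤ (2 * (N - 2 * M)) ^ d := hn'.le.trans (Nat.pow_le_pow_left (by omega) d)
    _ = 2 ^ d * (Fintype.piFinset fun _ : Fin d => Finset.Icc (1 + M : ℤ) (N - M)).card := by
        rw [card_intCube, mul_pow]
        congr 3
        omega
    _ ≤ 2 ^ d * I.card := by
        grw [Finset.card_le_card hsub, Finset.card_image_le]

lemma IsGridEnumeration.eventually_sum_le_gridAverage (hv : IsGridEnumeration v) (hd : 0 < d)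
    (G : (Fin d → ℤ) → ℝ≥0∞) (F : Finset (Fin d → ℤ)) :
    ∀ᶠ n : ℕ in atTop, ∑ w ∈ F, G w ≤ 2 ^ d * gridAverage v G n := by
  obtain ⟨M, hM⟩ :=
    ((F ×ˢ Finset.univ).image fun q : (Fin d → ℤ) × Fin d => (q.1 q.2).natAbs).exists_le
  have hF : ∀ w ∈ F, ∀ k, |w k| ≤ M := fun w hw k => by
    have hle := hM _ (Finset.mem_image_of_mem _ (Finset.mk_mem_product hw (Finset.mem_univ k)))
    rw [Int.abs_eq_natAbs]
    exact_mod_cast hle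
  filter_upwards [eventually_ge_atTop ((4 * M + 1) ^ d)] with n hn
  have hn0 : n ≠ 0 := (lt_of_lt_of_le (by positivity) hn).ne'
  set N := Nat.nthRoot d n
  have hNn : N ^ d ≤ n := Nat.pow_nthRoot_le (.inl hd.ne')
  have hnN : n < (N + 1) ^ d := Nat.lt_pow_nthRoot_add_one hd.ne' n
  have hMN : 4 * M < N :=
    Nat.succ_lt_succ_iff.1 (lt_of_pow_lt_pow_left₀ d (by omega) (hn.trans_lt hnN))
  set I := {i : Fin n | ∀ k, v i k ∈ Finset.Icc (1 + M : ℤ) (N - M)}.toFinset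
  have hcard : n ≤ 2 ^ d * I.card := hv.le_card_interior hMN hNn hnN
  have hcard' : (n : ℝ≥0∞) ≤ 2 ^ d * I.card := by exact_mod_cast hcard
  calc ∑ w ∈ F, G w = (n : ℝ≥0∞)⁻¹ * (n * ∑ w ∈ F, G w) := by
        rw [← mul_assoc, ENNReal.inv_mul_cancel (by exact_mod_cast hn0) (by finiteness), one_mul]
    _ ≤ (n : ℝ≥0∞)⁻¹ * (2 ^ d * ∑ _i ∈ I, ∑ w ∈ F, G w) := by
        rw [Finset.sum_const, nsmul_eq_mul, ← mul_assoc (2 ^ d)]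
        grw [← hcard']
    _ ≤ (n : ℝ≥0∞)⁻¹ * (2 ^ d * ∑ i ∈ I, ∑ j : Fin n, G (v i - v j)) := by
        gcongr with i hi
        exact hv.sum_le_sum_sub (by omega) hNn hF (Set.mem_toFinset.1 hi) G
    _ ≤ (n : ℝ≥0∞)⁻¹ * (2 ^ d * ∑ i : Fin n, ∑ j : Fin n, G (v i - v j)) := by
        gcongr
        exact Finset.subset_univ I
    _ = 2 ^ d * gridAverage v G n := mul_left_comm _ _ _

lemma IsGridEnumeration.tsum_le_liminf_gridAverage (hv : IsGridEnumeration v) (hd : 0 < d)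
    (G : (Fin d → ℤ) → ℝ≥0∞) :
    ∑' w, G w ≤ 2 ^ d * liminf (gridAverage v G) atTop := by
  refine ENNReal.summable.tsum_le_of_sum_le fun F => ?_
  rw [← ENNReal.liminf_const_mul_of_ne_top (by finiteness)]
  exact le_liminf_of_le (by isBoundedDefault) (hv.eventually_sum_le_gridAverage hd G F)

end Grid

section Separation

variable {d : ℕ}

lemma latticePoint_zero : latticePoint (0 : Fin d → ℤ) = 0 := by
  ext k; simp [latticePoint]

lemma latticePoint_sub (w w' : Fin d → ℤ) :
    latticePoint (w - w') = latticePoint w - latticePoint w' := by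
  ext k; simp [latticePoint]

lemma obsPoint_sub (v : ℕ → Fin d → ℤ) (ε : ℝ) (x : ℕ → EuclideanSpace ℝ (Fin d)) (i j : ℕ) :
    obsPoint v ε x i - obsPoint v ε x j = latticePoint (v i - v j) + ε • (x i - x j) := by
  rw [obsPoint, obsPoint, latticePoint_sub, smul_sub]
  abel

lemma one_le_norm_int {w : Fin d → ℤ} (hw : w ≠ 0) : 1 ≤ ‖w‖ := by
  obtain ⟨k, hk⟩ := Function.ne_iff.1 hw
  calc (1 : ℝ) ≤ ‖w k‖ := by
        rw [Int.norm_eq_abs]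
        exact_mod_cast Int.one_le_abs hk
    _ ≤ ‖w‖ := norm_le_pi_norm w k

lemma mul_norm_le_norm_latticePoint_add {ε : ℝ} (hε : 0 ≤ ε) {x y : EuclideanSpace ℝ (Fin d)}
    (hx : ∀ k, -1 ≤ x k ∧ x k ≤ 1) (hy : ∀ k, -1 ≤ y k ∧ y k ≤ 1) (w : Fin d → ℤ) :
    (1 - 2 * ε) * ‖w‖ ≤ ‖latticePoint w + ε • (x - y)‖ := by
  rcases eq_or_ne w 0 with rfl | hw
  · simp
  have hle : ‖w‖ ≤ ‖latticePoint w + ε • (x - y)‖ + 2 * ε := by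
    refine (pi_norm_le_iff_of_nonneg (by positivity)).2 fun k => ?_
    have hcoord : |(w k : ℝ) + ε * (x k - y k)| ≤ ‖latticePoint w + ε • (x - y)‖ := by
      simpa [latticePoint] using PiLp.norm_apply_le (latticePoint w + ε • (x - y)) k
    have hpert : |x k - y k| ≤ 2 :=
      abs_le.2 ⟨by linarith [(hx k).1, (hy k).2], by linarith [(hx k).2, (hy k).1]⟩
    calc ‖w k‖ = |((w k : ℝ) + ε * (x k - y k)) - ε * (x k - y k)| := by
          rw [add_sub_cancel_right, Int.norm_eq_abs]
      _ ≤ |(w k : ℝ) + ε * (x k - y k)| + ε * |x k - y k| := by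
          grw [abs_sub, abs_mul, abs_of_nonneg hε]
      _ ≤ ‖latticePoint w + ε • (x - y)‖ + 2 * ε := by grw [hcoord, hpert, mul_comm ε]
  nlinarith [one_le_norm_int hw]

lemma isLatticeSeparated_obsPoint {v : ℕ → Fin d → ℤ} (hv : Function.Injective v) {ε : ℝ}
    (hε : 0 ≤ ε) {x : ℕ → EuclideanSpace ℝ (Fin d)} (hx : ∀ i k, -1 ≤ x i k ∧ x i k ≤ 1) (n : ℕ) :
    IsLatticeSeparated (1 - 2 * ε) fun i : Fin n => obsPoint v ε x i := by
  refine ⟨fun i => v i, fun i j h => Fin.ext (hv h), fun i j => ?_⟩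
  rw [obsPoint_sub]
  exact mul_norm_le_norm_latticePoint_add hε (hx i) (hx j) _

end Separation

/-! ### Perturbed grids -/

section PairMeasure

variable {d : ℕ} {ε : ℝ} {μ : Measure (EuclideanSpace ℝ (Fin d))}

/-- The law of `w + ε (x - y)` for independent `x`, `y` with law `μ`, replaced by `0` at `w = 0`:
the two observation points then coincide. -/
noncomputable def pairLaw (μ : Measure (EuclideanSpace ℝ (Fin d))) (ε : ℝ) (w : Fin d → ℤ) :
    Measure (EuclideanSpace ℝ (Fin d)) :=
  if w = 0 then 0 else (μ.prod μ).map fun q => latticePoint w + ε • (q.1 - q.2)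

/-- The intensity of the differences between a point of the randomly perturbed lattice and the
other points. -/
noncomputable def pairMeasure (μ : Measure (EuclideanSpace ℝ (Fin d))) (ε : ℝ) :
    Measure (EuclideanSpace ℝ (Fin d)) :=
  Measure.sum (pairLaw μ ε)

lemma pairLaw_zero : pairLaw μ ε 0 = 0 := if_pos rfl

lemma pairLaw_of_ne {w : Fin d → ℤ} (hw : w ≠ 0) :
    pairLaw μ ε w = (μ.prod μ).map fun q => latticePoint w + ε • (q.1 - q.2) := if_neg hw

lemma lintegral_decay_pairLaw_le [IsProbabilityMeasure μ]
    (hμ : ∀ x ∈ μ.support, ∀ k, -1 ≤ x k ∧ x k ≤ 1) (hε : 0 ≤ ε) (hε_lt : ε < 1 / 2)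
    (w : Fin d → ℤ) :
    ∫⁻ t, ENNReal.ofReal (decay d t) ∂(pairLaw μ ε w) ≤
      ENNReal.ofReal ((1 - 2 * ε)⁻¹ ^ (d + 1) * ‖w‖⁻¹ ^ (d + 1)) := by
  rcases eq_or_ne w 0 with rfl | hw
  · simp [pairLaw_zero]
  have hdecay : Measurable (decay d) := continuous_decay.measurable
  have hcube : ∀ᵐ x ∂μ, ∀ k, -1 ≤ x k ∧ x k ≤ 1 := by
    filter_upwards [Measure.support_mem_ae (μ := μ)] with x hx using hμ x hx
  have hpos : 0 < (1 - 2 * ε) * ‖w‖ := mul_pos (by linarith) (norm_pos_iff.2 hw)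
  rw [pairLaw_of_ne hw, lintegral_map (by fun_prop) (by fun_prop)]
  calc ∫⁻ q, ENNReal.ofReal (decay d (latticePoint w + ε • (q.1 - q.2))) ∂(μ.prod μ)
      ≤ ∫⁻ _, ENNReal.ofReal ((1 - 2 * ε)⁻¹ ^ (d + 1) * ‖w‖⁻¹ ^ (d + 1)) ∂(μ.prod μ) := by
        refine lintegral_mono_ae ?_
        filter_upwards [Measure.quasiMeasurePreserving_fst.ae hcube,
          Measure.quasiMeasurePreserving_snd.ae hcube] with q hq₁ hq₂
        have hle := mul_norm_le_norm_latticePoint_add hε hq₁ hq₂ w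
        rw [← mul_pow, ← mul_inv]
        grw [decay_le_inv_norm_pow (norm_pos_iff.1 (hpos.trans_le hle)), hle]
    _ = ENNReal.ofReal ((1 - 2 * ε)⁻¹ ^ (d + 1) * ‖w‖⁻¹ ^ (d + 1)) := by simp

lemma integrable_decay_pairMeasure [IsProbabilityMeasure μ]
    (hμ : ∀ x ∈ μ.support, ∀ k, -1 ≤ x k ∧ x k ≤ 1) (hε : 0 ≤ ε) (hε_lt : ε < 1 / 2) :
    Integrable (decay d) (pairMeasure μ ε) := by
  refine ⟨continuous_decay.aestronglyMeasurable, ?_⟩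
  rw [hasFiniteIntegral_iff_ofReal (Eventually.of_forall decay_nonneg), pairMeasure,
    lintegral_sum_measure]
  exact (ENNReal.tsum_le_tsum (lintegral_decay_pairLaw_le hμ hε hε_lt)).trans_lt
    ((summable_inv_norm_pow_int d).mul_left _).tsum_ofReal_lt_top

lemma map_add_smul_sub_absolutelyContinuous [SFinite μ] (hμ : μ ≪ volume) (hε : ε ≠ 0)
    (c : EuclideanSpace ℝ (Fin d)) :
    (μ.prod μ).map (fun q => c + ε • (q.1 - q.2)) ≪ volume := by
  refine Measure.AbsolutelyContinuous.mk fun s hs hs0 => ?_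
  have hm : Measurable fun q : EuclideanSpace ℝ (Fin d) × EuclideanSpace ℝ (Fin d) =>
    c + ε • (q.1 - q.2) := by fun_prop
  rw [Measure.map_apply hm hs, Measure.measure_prod_null (hm hs)]
  refine Eventually.of_forall fun x => hμ ?_
  have hsection : Prod.mk x ⁻¹' ((fun q => c + ε • (q.1 - q.2)) ⁻¹' s) =
      ((-ε) • ·) ⁻¹' ((c + ε • x + ·) ⁻¹' s) := by
    ext y
    simp only [Set.mem_preimage, smul_sub, neg_smul, ← sub_eq_add_neg, add_sub_assoc]
  rw [hsection, Measure.addHaar_preimage_smul _ (neg_ne_zero.2 hε), measure_preimage_add, hs0,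
    mul_zero]

lemma pairMeasure_absolutelyContinuous [SFinite μ] (hμ : μ ≪ volume) (hε : ε ≠ 0) :
    pairMeasure μ ε ≪ volume.restrict (diffDomain ε μ.support) := by
  refine Measure.absolutelyContinuous_sum_left fun w => ?_
  rcases eq_or_ne w 0 with rfl | hw
  · rw [pairLaw_zero]
    exact Measure.AbsolutelyContinuous.zero _
  rw [pairLaw_of_ne hw]
  refine Measure.AbsolutelyContinuous.mk fun s hs hs0 => ?_
  rw [Measure.restrict_apply hs] at hs0
  have hnull := map_add_smul_sub_absolutelyContinuous hμ hε (latticePoint w) hs0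
  have hsupp : ∀ᵐ x ∂μ, x ∈ μ.support := Measure.support_mem_ae
  rw [Measure.map_apply (by fun_prop) hs]
  have hnull' := nonpos_iff_eq_zero.1 ((Measure.le_map_apply (by fun_prop) _).trans hnull.le)
  refine measure_mono_null_ae ?_ hnull'
  filter_upwards [Measure.quasiMeasurePreserving_fst.ae hsupp,
    Measure.quasiMeasurePreserving_snd.ae hsupp] with q hq₁ hq₂ hq
  exact ⟨hq, w, hw, q.1, hq₁, q.2, hq₂, rfl⟩

lemma diffDomain_subset_support_pairMeasure [SFinite μ] :
    diffDomain ε μ.support ⊆ (pairMeasure μ ε).support := by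
  rintro _ ⟨w, hw, t₁, ht₁, t₂, ht₂, rfl⟩
  refine (Measure.mem_support_iff_forall _).2 fun U hU => ?_
  have hcont : Continuous fun q : EuclideanSpace ℝ (Fin d) × EuclideanSpace ℝ (Fin d) =>
    latticePoint w + ε • (q.1 - q.2) := by fun_prop
  obtain ⟨V₁, hV₁, V₂, hV₂, hV⟩ := mem_nhds_prod_iff.1 (hcont.continuousAt (x := (t₁, t₂)) hU)
  calc 0 < μ V₁ * μ V₂ := ENNReal.mul_pos
        ((Measure.mem_support_iff_forall _).1 ht₁ V₁ hV₁).ne'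
        ((Measure.mem_support_iff_forall _).1 ht₂ V₂ hV₂).ne'
    _ = (μ.prod μ) (V₁ ×ˢ V₂) := (Measure.prod_prod _ _).symm
    _ ≤ (μ.prod μ) ((fun q => latticePoint w + ε • (q.1 - q.2)) ⁻¹' U) := measure_mono hV
    _ ≤ pairLaw μ ε w U := by
        rw [pairLaw_of_ne hw]
        exact Measure.le_map_apply hcont.aemeasurable U
    _ ≤ pairMeasure μ ε U := Measure.le_sum _ w U

lemma eq_zero_on_support_of_integral_eq_zero {E : Type*} [TopologicalSpace E] [MeasurableSpace E]
    [OpensMeasurableSpace E] {Q : Measure E} {g : E → ℝ} (hg : Continuous g) (hg₀ : 0 ≤ g)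
    (hi : Integrable g Q) (h : ∫ t, g t ∂Q = 0) {t : E} (ht : t ∈ Q.support) : g t = 0 := by
  by_contra hne
  have hopen : IsOpen {t | g t ≠ 0} := isOpen_ne.preimage hg
  exact Measure.subset_compl_support_of_isOpen hopen
    (ae_iff.1 ((integral_eq_zero_iff_of_nonneg hg₀ hi).1 h)) hne ht

lemma integral_pairMeasure_eq_zero_iff [SFinite μ] (hμ : μ ≪ volume) (hε : ε ≠ 0)
    {g : EuclideanSpace ℝ (Fin d) → ℝ} (hg : Continuous g) (hg₀ : 0 ≤ g)
    (hi : Integrable g (pairMeasure μ ε)) (hi' : IntegrableOn g (diffDomain ε μ.support)) :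
    ∫ t, g t ∂(pairMeasure μ ε) = 0 ↔ ∫ t in diffDomain ε μ.support, g t = 0 := by
  constructor
  · refine fun h => setIntegral_eq_zero_of_forall_eq_zero fun t ht => ?_
    exact eq_zero_on_support_of_integral_eq_zero hg hg₀ hi h
      (diffDomain_subset_support_pairMeasure ht)
  · intro h
    have hae := (integral_eq_zero_iff_of_nonneg hg₀ hi').1 h
    exact integral_eq_zero_of_ae ((pairMeasure_absolutelyContinuous hμ hε).ae_le hae)

lemma hasSum_latticePoint [IsProbabilityMeasure μ] {g : EuclideanSpace ℝ (Fin d) → ℝ}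
    (hg : g 0 = 0) (hi : Integrable g (pairMeasure μ 0)) :
    HasSum (fun w => g (latticePoint w)) (∫ t, g t ∂(pairMeasure μ 0)) := by
  have hterm (w : Fin d → ℤ) : ∫ t, g t ∂(pairLaw μ 0 w) = g (latticePoint w) := by
    rcases eq_or_ne w 0 with rfl | hw
    · rw [pairLaw_zero, integral_zero_measure, latticePoint_zero, hg]
    · rw [pairLaw_of_ne hw]
      simp only [zero_smul, add_zero, Measure.map_const, measure_univ, one_smul, integral_dirac]
  simp only [← hterm]
  exact hasSum_integral_measure hi

end PairMeasure

section PerturbedGrid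

variable {d : ℕ} {v : ℕ → Fin d → ℤ} {ε : ℝ} {μ : Measure (EuclideanSpace ℝ (Fin d))}
  {ΩX : Type*} [MeasurableSpace ΩX] {X : ℕ → ΩX → EuclideanSpace ℝ (Fin d)} {PX : Measure ΩX}

/-- The sampling design `v i + ε X i`: a cube-filling enumeration `v` of a lattice orthant whose
points are moved independently, by less than half the mesh, with common law `μ`. Only
pairwise independence is assumed, as the bounds only involve the joint laws of pairs of points. -/
structure IsPerturbedGrid (v : ℕ → Fin d → ℤ) (ε : ℝ) (μ : Measure (EuclideanSpace ℝ (Fin d)))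
    (X : ℕ → ΩX → EuclideanSpace ℝ (Fin d)) (PX : Measure ΩX) : Prop where
  enumeration : IsGridEnumeration v
  scale_nonneg : 0 ≤ ε
  scale_lt : ε < 1 / 2
  support_subset : ∀ x ∈ μ.support, ∀ k, -1 ≤ x k ∧ x k ≤ 1
  measurable : ∀ i, Measurable (X i)
  indep : Pairwise fun i j => IndepFun (X i) (X j) PX
  law : ∀ i, PX.map (X i) = μ

lemma IsPerturbedGrid.isProbabilityMeasure [IsProbabilityMeasure PX]
    (h : IsPerturbedGrid v ε μ X PX) : IsProbabilityMeasure μ := by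
  rw [← h.law 0]
  exact Measure.isProbabilityMeasure_map (h.measurable 0).aemeasurable

lemma IsPerturbedGrid.ae_isLatticeSeparated (h : IsPerturbedGrid v ε μ X PX) (hd : 0 < d) (n : ℕ) :
    ∀ᵐ ω ∂PX, IsLatticeSeparated (1 - 2 * ε) fun i : Fin n => obsPoint v ε (X · ω) i := by
  have hcube : ∀ᵐ ω ∂PX, ∀ i k, -1 ≤ X i ω k ∧ X i ω k ≤ 1 := by
    refine ae_all_iff.2 fun i => ae_of_ae_map (h.measurable i).aemeasurable
      (p := fun x => ∀ k, -1 ≤ x k ∧ x k ≤ 1) ?_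
    rw [h.law i]
    filter_upwards [Measure.support_mem_ae (μ := μ)] with x hx using h.support_subset x hx
  filter_upwards [hcube] with ω hω
  exact isLatticeSeparated_obsPoint (h.enumeration.injective hd) h.scale_nonneg hω n

lemma IsPerturbedGrid.lintegral_obsPoint_sub [IsProbabilityMeasure PX]
    (h : IsPerturbedGrid v ε μ X PX) (hd : 0 < d) {g : EuclideanSpace ℝ (Fin d) → ℝ≥0∞}
    (hg : Measurable g) (hg₀ : g 0 = 0) (i j : ℕ) :
    ∫⁻ ω, g (obsPoint v ε (X · ω) i - obsPoint v ε (X · ω) j) ∂PX =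
      ∫⁻ t, g t ∂(pairLaw μ ε (v i - v j)) := by
  rcases eq_or_ne i j with rfl | hij
  · simp [pairLaw_zero, hg₀]
  have hne : v i - v j ≠ 0 := sub_ne_zero.2 ((h.enumeration.injective hd).ne hij)
  have hlaw : PX.map (fun ω => (X i ω, X j ω)) = μ.prod μ := by
    rw [(indepFun_iff_map_prod_eq_prod_map_map (h.measurable i).aemeasurable
      (h.measurable j).aemeasurable).1 (h.indep hij), h.law, h.law]
  simp only [obsPoint_sub]
  rw [pairLaw_of_ne hne, lintegral_map hg (by fun_prop), ← hlaw,
    lintegral_map (by fun_prop) ((h.measurable i).prodMk (h.measurable j))]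

lemma IsPerturbedGrid.measurable_obsPoint (h : IsPerturbedGrid v ε μ X PX) (i : ℕ) :
    Measurable fun ω => obsPoint v ε (X · ω) i :=
  ((h.measurable i).const_smul ε).const_add _

lemma IsPerturbedGrid.lintegral_sum_obsPoint_sub [IsProbabilityMeasure PX]
    (h : IsPerturbedGrid v ε μ X PX) (hd : 0 < d) {g : EuclideanSpace ℝ (Fin d) → ℝ≥0∞}
    (hg : Measurable g) (hg₀ : g 0 = 0) (n : ℕ) :
    ∫⁻ ω, (n : ℝ≥0∞)⁻¹ * ∑ i : Fin n, ∑ j : Fin n,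
        g (obsPoint v ε (X · ω) i - obsPoint v ε (X · ω) j) ∂PX =
      gridAverage v (fun w => ∫⁻ t, g t ∂(pairLaw μ ε w)) n := by
  have hm (i j : Fin n) : Measurable fun ω =>
      g (obsPoint v ε (X · ω) i - obsPoint v ε (X · ω) j) :=
    hg.comp ((h.measurable_obsPoint i).sub (h.measurable_obsPoint j))
  have hm_row (i : Fin n) := Finset.measurable_fun_sum Finset.univ fun j _ => hm i j
  rw [lintegral_const_mul _ (Finset.measurable_fun_sum _ fun i _ => hm_row i),
    lintegral_finsetSum _ fun i _ => hm_row i, gridAverage]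
  congr! 2 with i
  rw [lintegral_finsetSum _ fun j _ => hm i j]
  congr! 1 with j
  exact h.lintegral_obsPoint_sub hd hg hg₀ i j

end PerturbedGrid

/-! ### Asymptotics of the excess prediction error -/

section EReal

lemma coe_lintegral_le_sub {Ω : Type*} [MeasurableSpace Ω] {P : Measure Ω} {F f f₀ : Ω → ℝ≥0∞}
    (hF : Measurable F) (hf₀ : ∫⁻ ω, f₀ ω ∂P ≠ ∞) (h : ∀ᵐ ω ∂P, F ω + f₀ ω ≤ f ω) :
    ((∫⁻ ω, F ω ∂P : ℝ≥0∞) : EReal) ≤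
      ((∫⁻ ω, f ω ∂P : ℝ≥0∞) : EReal) - ((∫⁻ ω, f₀ ω ∂P : ℝ≥0∞) : EReal) := by
  rw [EReal.le_sub_iff_add_le (.inl (EReal.coe_ennreal_ne_bot _))
    (.inl (EReal.coe_ennreal_eq_top_iff.not.2 hf₀)), ← EReal.coe_ennreal_add,
    EReal.coe_ennreal_le_coe_ennreal_iff, ← lintegral_add_left hF]
  exact lintegral_mono_ae h

lemma sub_le_coe_lintegral {Ω : Type*} [MeasurableSpace Ω] {P : Measure Ω} {F f f₀ : Ω → ℝ≥0∞}
    (hF : Measurable F) (h : ∀ᵐ ω ∂P, f ω ≤ F ω + f₀ ω) :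
    ((∫⁻ ω, f ω ∂P : ℝ≥0∞) : EReal) - ((∫⁻ ω, f₀ ω ∂P : ℝ≥0∞) : EReal) ≤
      ((∫⁻ ω, F ω ∂P : ℝ≥0∞) : EReal) := by
  rw [EReal.sub_le_iff_le_add (.inl (EReal.coe_ennreal_ne_bot _))
    (.inr (EReal.coe_ennreal_ne_bot _)), ← EReal.coe_ennreal_add,
    EReal.coe_ennreal_le_coe_ennreal_iff, ← lintegral_add_left hF]
  exact lintegral_mono_ae h

lemma inv_mul_sum_sum_ofReal {n : ℕ} {a : Fin n → Fin n → ℝ} (ha : ∀ i j, 0 ≤ a i j) :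
    (n : ℝ≥0∞)⁻¹ * ∑ i, ∑ j, ENNReal.ofReal (a i j) =
      ENNReal.ofReal ((1 / (n : ℝ)) * ∑ i, ∑ j, a i j) := by
  rcases n.eq_zero_or_pos with rfl | hn
  · simp
  · rw [ENNReal.ofReal_mul (by positivity), one_div,
      ENNReal.ofReal_inv_of_pos (by exact_mod_cast hn), ENNReal.ofReal_natCast,
      ENNReal.ofReal_sum_of_nonneg fun i _ => Finset.sum_nonneg fun j _ => ha i j]
    congr! 2 with i
    rw [ENNReal.ofReal_sum_of_nonneg fun j _ => ha i j]

end EReal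

section Design

variable {d : ℕ} {k : EuclideanSpace ℝ (Fin d) → ℝ} {v : ℕ → Fin d → ℤ} {ε : ℝ} {ΩX : Type*}
  {X : ℕ → ΩX → EuclideanSpace ℝ (Fin d)} {n : ℕ}

/-- The covariance matrix, for the covariance function `k`, of the first `n` observations made at
the random points `v i + ε X i ω`. -/
noncomputable def designCov (k : EuclideanSpace ℝ (Fin d) → ℝ) (v : ℕ → Fin d → ℤ) (ε : ℝ)
    (X : ℕ → ΩX → EuclideanSpace ℝ (Fin d)) (n : ℕ) (ω : ΩX) : Matrix (Fin n) (Fin n) ℝ :=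
  covMatrix k fun i : Fin n => obsPoint v ε (X · ω) i

lemma diag_designCov (hk : k 0 = 1) (ω : ΩX) : (designCov k v ε X n ω).diag = 1 := by
  ext i
  simp [designCov, covMatrix, hk]

/-- `(1/n) ∑ i, ∑ j, (k (s i - s j) - k₀ (s i - s j))²` at the design points `s i = v i + ε X i`. -/
noncomputable def designSqDist (k k₀ : EuclideanSpace ℝ (Fin d) → ℝ) (v : ℕ → Fin d → ℤ) (ε : ℝ)
    (X : ℕ → ΩX → EuclideanSpace ℝ (Fin d)) (n : ℕ) (ω : ΩX) : ℝ≥0∞ :=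
  ENNReal.ofReal ((1 / (n : ℝ)) *
    ∑ i, ∑ j, (designCov k v ε X n ω i j - designCov k₀ v ε X n ω i j) ^ 2)

lemma designSqDist_eq (k k₀ : EuclideanSpace ℝ (Fin d) → ℝ) (ω : ΩX) :
    designSqDist k k₀ v ε X n ω = (n : ℝ≥0∞)⁻¹ * ∑ i : Fin n, ∑ j : Fin n,
      (fun t => ENNReal.ofReal ((k t - k₀ t) ^ 2))
        (obsPoint v ε (X · ω) i - obsPoint v ε (X · ω) j) :=
  (inv_mul_sum_sum_ofReal fun _ _ => sq_nonneg _).symm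

end Design

section Excess

variable {d : ℕ} {k k₀ : EuclideanSpace ℝ (Fin d) → ℝ} {v : ℕ → Fin d → ℤ} {ε : ℝ}
  {μ : Measure (EuclideanSpace ℝ (Fin d))} {ΩX ΩY : Type*} [MeasurableSpace ΩX]
  [MeasurableSpace ΩY] {X : ℕ → ΩX → EuclideanSpace ℝ (Fin d)} {PX : Measure ΩX}
  {Y : EuclideanSpace ℝ (Fin d) → ΩY → ℝ} {PY : Measure ΩY} {b : ℝ} {n : ℕ}

lemma looMSE_eq_lintegral_looForm (hY : IsCenteredGaussianField k₀ Y PY)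
    (hb : ∀ᵐ ω ∂PX, WellConditioned b (designCov k v ε X n ω))
    (hb₀ : ∀ᵐ ω ∂PX, WellConditioned b (designCov k₀ v ε X n ω)) :
    looMSE k v ε X PX Y PY n = ∫⁻ ω, ENNReal.ofReal
      ((1 / (n : ℝ)) * looForm (designCov k v ε X n ω) (designCov k₀ v ε X n ω)) ∂PX := by
  refine lintegral_congr_ae ?_
  filter_upwards [hb, hb₀] with ω hω hω₀ using lintegral_sq_sub_krigingPred hY hω hω₀

lemma lintegral_looForm_self_ne_top [IsFiniteMeasure PX]
    (hb : ∀ᵐ ω ∂PX, WellConditioned b (designCov k v ε X n ω)) :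
    ∫⁻ ω, ENNReal.ofReal
      ((1 / (n : ℝ)) * looForm (designCov k v ε X n ω) (designCov k v ε X n ω)) ∂PX ≠ ∞ := by
  refine ne_top_of_le_ne_top (b := ∫⁻ _, ENNReal.ofReal ((1 / (n : ℝ)) * (b * n)) ∂PX)
    (by rw [lintegral_const]; finiteness) (lintegral_mono_ae ?_)
  filter_upwards [hb] with ω hω
  have hle := hω.looForm_self_le
  rw [Fintype.card_fin] at hle
  gcongr

lemma measurable_designSqDist (hX : IsPerturbedGrid v ε μ X PX) (hk : Continuous k)
    (hk₀ : Continuous k₀) : Measurable (designSqDist k k₀ v ε X n) := by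
  have hobs := hX.measurable_obsPoint
  have hkm := hk.measurable
  have hkm₀ := hk₀.measurable
  unfold designSqDist designCov covMatrix
  simp only [Matrix.of_apply]
  fun_prop

lemma lintegral_designSqDist [IsProbabilityMeasure PX] (hX : IsPerturbedGrid v ε μ X PX)
    (hd : 0 < d) (hk : Continuous k) (hk₀ : Continuous k₀) (h0 : k 0 = k₀ 0) :
    ∫⁻ ω, designSqDist k k₀ v ε X n ω ∂PX =
      gridAverage v (fun w => ∫⁻ t, ENNReal.ofReal ((k t - k₀ t) ^ 2) ∂(pairLaw μ ε w)) n := by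
  simp only [designSqDist_eq]
  have hkm := hk.measurable
  have hkm₀ := hk₀.measurable
  exact hX.lintegral_sum_obsPoint_sub hd (g := fun t => ENNReal.ofReal ((k t - k₀ t) ^ 2))
    (by fun_prop) (by simp [h0]) n

lemma le_looExcess [IsFiniteMeasure PX] (hX : IsPerturbedGrid v ε μ X PX)
    (hY : IsCenteredGaussianField k₀ Y PY) (hk : Continuous k) (hk₀ : Continuous k₀)
    (h1 : k 0 = 1) (h1₀ : k₀ 0 = 1) (hb : ∀ᵐ ω ∂PX, WellConditioned b (designCov k v ε X n ω))
    (hb₀ : ∀ᵐ ω ∂PX, WellConditioned b (designCov k₀ v ε X n ω)) :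
    ((ENNReal.ofReal (4 * b ^ 17)⁻¹ * ∫⁻ ω, designSqDist k k₀ v ε X n ω ∂PX : ℝ≥0∞) : EReal) ≤
      looExcess k k₀ v ε X PX Y PY n := by
  have hm : Measurable (designSqDist k k₀ v ε X n) := measurable_designSqDist hX hk hk₀
  rw [looExcess, looMSE_eq_lintegral_looForm hY hb hb₀, looMSE_eq_lintegral_looForm hY hb₀ hb₀,
    ← lintegral_const_mul _ hm]
  refine coe_lintegral_le_sub (hm.const_mul _) (lintegral_looForm_self_ne_top hb₀) ?_
  filter_upwards [hb, hb₀] with ω hω hω₀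
  have hpos := hω.pos
  have hnonneg := hω₀.looForm_nonneg (R := designCov k₀ v ε X n ω)
  rw [designSqDist, ← ENNReal.ofReal_mul (by positivity),
    ← ENNReal.ofReal_add (by positivity) (by positivity), mul_left_comm, ← mul_add]
  gcongr
  linarith [hω.le_looForm_sub_looForm_self hω₀ (diag_designCov h1 ω) (diag_designCov h1₀ ω)]

lemma looExcess_le (hX : IsPerturbedGrid v ε μ X PX)
    (hY : IsCenteredGaussianField k₀ Y PY) (hk : Continuous k) (hk₀ : Continuous k₀)
    (hb : ∀ᵐ ω ∂PX, WellConditioned b (designCov k v ε X n ω))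
    (hb₀ : ∀ᵐ ω ∂PX, WellConditioned b (designCov k₀ v ε X n ω)) :
    looExcess k k₀ v ε X PX Y PY n ≤
      ((ENNReal.ofReal (4 * b ^ 11) * ∫⁻ ω, designSqDist k k₀ v ε X n ω ∂PX : ℝ≥0∞) : EReal) := by
  have hm : Measurable (designSqDist k k₀ v ε X n) := measurable_designSqDist hX hk hk₀
  rw [looExcess, looMSE_eq_lintegral_looForm hY hb hb₀, looMSE_eq_lintegral_looForm hY hb₀ hb₀,
    ← lintegral_const_mul _ hm]
  refine sub_le_coe_lintegral (hm.const_mul _) ?_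
  filter_upwards [hb, hb₀] with ω hω hω₀
  have hpos := hω.pos
  have hnonneg := hω₀.looForm_nonneg (R := designCov k₀ v ε X n ω)
  rw [designSqDist, ← ENNReal.ofReal_mul (by positivity),
    ← ENNReal.ofReal_add (by positivity) (by positivity), mul_left_comm, ← mul_add]
  gcongr
  linarith [hω.looForm_sub_looForm_self_le hω₀]

end Excess

section Limits

variable {d : ℕ} {v : ℕ → Fin d → ℤ}

lemma IsGridEnumeration.le_liminf_of_gridAverage_le (hv : IsGridEnumeration v) (hd : 0 < d)
    {G : (Fin d → ℤ) → ℝ≥0∞} {c : ℝ≥0∞} (hc : c ≠ ∞) {D : ℕ → EReal}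
    (h : ∀ n, ((c * gridAverage v G n : ℝ≥0∞) : EReal) ≤ D n) :
    ((c / 2 ^ d * ∑' w, G w : ℝ≥0∞) : EReal) ≤ liminf D atTop := by
  have hle : c / 2 ^ d * ∑' w, G w ≤ liminf (fun n => c * gridAverage v G n) atTop := by
    rw [ENNReal.liminf_const_mul_of_ne_top hc]
    calc c / 2 ^ d * ∑' w, G w ≤ c / 2 ^ d * (2 ^ d * liminf (gridAverage v G) atTop) := by
          grw [hv.tsum_le_liminf_gridAverage hd G]
      _ = c * liminf (gridAverage v G) atTop := by
          rw [← mul_assoc, ENNReal.div_mul_cancel (by positivity) (by finiteness)]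
  calc ((c / 2 ^ d * ∑' w, G w : ℝ≥0∞) : EReal)
      ≤ (liminf (fun n => c * gridAverage v G n) atTop : ℝ≥0∞) := by exact_mod_cast hle
    _ = liminf (fun n => ((c * gridAverage v G n : ℝ≥0∞) : EReal)) atTop :=
        Monotone.map_liminf_of_continuousAt (f := ((↑) : ℝ≥0∞ → EReal))
          (fun _ _ => EReal.coe_ennreal_le_coe_ennreal_iff.2) _
          continuous_coe_ennreal_ereal.continuousAt
    _ ≤ liminf D atTop := liminf_le_liminf (.of_forall h)

lemma limsup_le_of_le_gridAverage (hv : Function.Injective v) {G : (Fin d → ℤ) → ℝ≥0∞}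
    {c : ℝ≥0∞} {D : ℕ → EReal} (h : ∀ n, D n ≤ ((c * gridAverage v G n : ℝ≥0∞) : EReal)) :
    limsup D atTop ≤ ((c * ∑' w, G w : ℝ≥0∞) : EReal) := by
  refine limsup_le_of_le (by isBoundedDefault) (.of_forall fun n => (h n).trans ?_)
  rw [EReal.coe_ennreal_le_coe_ennreal_iff]
  grw [gridAverage_le_tsum hv G n]

lemma coe_ofReal_mul_tsum_lintegral_pairLaw {μ : Measure (EuclideanSpace ℝ (Fin d))} {ε a : ℝ}
    (ha : 0 ≤ a) {g : EuclideanSpace ℝ (Fin d) → ℝ} (hg : 0 ≤ g)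
    (hi : Integrable g (pairMeasure μ ε)) :
    ((ENNReal.ofReal a * ∑' w, ∫⁻ t, ENNReal.ofReal (g t) ∂(pairLaw μ ε w) : ℝ≥0∞) : EReal) =
      ((a * ∫ t, g t ∂(pairMeasure μ ε) : ℝ) : EReal) := by
  rw [← lintegral_sum_measure, ← pairMeasure,
    ← ofReal_integral_eq_lintegral_ofReal hi (.of_forall hg), ← ENNReal.ofReal_mul ha,
    EReal.coe_ennreal_ofReal, max_eq_left (mul_nonneg ha (integral_nonneg hg))]

end Limits

section SpectralFamily

variable {d : ℕ} {T : Type*} [TopologicalSpace T] {S : Set T}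
  {k g : T → EuclideanSpace ℝ (Fin d) → ℝ} {v : ℕ → Fin d → ℤ} {ε : ℝ}
  {μ : Measure (EuclideanSpace ℝ (Fin d))} {ΩX ΩY : Type*} [MeasurableSpace ΩX]
  [MeasurableSpace ΩY] {X : ℕ → ΩX → EuclideanSpace ℝ (Fin d)} {PX : Measure ΩX}
  {Y : EuclideanSpace ℝ (Fin d) → ΩY → ℝ} {PY : Measure ΩY}

lemma IsSpectralFamily.exists_looExcess_bounds [IsProbabilityMeasure PX]
    (h : IsSpectralFamily S k g) (hS : IsCompact S) (hd : 0 < d) (hX : IsPerturbedGrid v ε μ X PX)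
    {τ₀ : T} (hτ₀ : τ₀ ∈ S) (hY : IsCenteredGaussianField (k τ₀) Y PY) :
    ∃ κ₁ κ₂ : ℝ, 0 < κ₁ ∧ κ₁ < κ₂ ∧ ∀ τ ∈ S,
      ((κ₁ * ∫ t, (k τ t - k τ₀ t) ^ 2 ∂(pairMeasure μ ε) : ℝ) : EReal) ≤
        liminf (fun n => looExcess (k τ) (k τ₀) v ε X PX Y PY n) atTop ∧
      limsup (fun n => looExcess (k τ) (k τ₀) v ε X PX Y PY n) atTop ≤
        ((κ₂ * ∫ t, (k τ t - k τ₀ t) ^ 2 ∂(pairMeasure μ ε) : ℝ) : EReal) := by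
  have hμ := hX.isProbabilityMeasure
  obtain ⟨b, hb⟩ := h.exists_wellConditioned hS (c := 1 - 2 * ε) (by linarith [hX.scale_lt])
  have hcond (n : ℕ) {τ : T} (hτ : τ ∈ S) :
      ∀ᵐ ω ∂PX, WellConditioned b (designCov (k τ) v ε X n ω) := by
    filter_upwards [hX.ae_isLatticeSeparated hd n] with ω hω using hb τ hτ n _ hω
  have hb1 : 1 ≤ b := ((hcond 0 hτ₀).exists.choose_spec).one_le
  have hdecay := integrable_decay_pairMeasure hX.support_subset hX.scale_nonneg hX.scale_lt
  have hone {τ : T} (hτ : τ ∈ S) := h.apply_zero τ hτ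
  have hdist (n : ℕ) {τ : T} (hτ : τ ∈ S) := lintegral_designSqDist (n := n) hX hd
    (h.continuous hτ) (h.continuous hτ₀) ((hone hτ).trans (hone hτ₀).symm)
  refine ⟨(4 * b ^ 17)⁻¹ / 2 ^ d, 4 * b ^ 11, by positivity, ?_, fun τ hτ => ⟨?_, ?_⟩⟩
  · calc (4 * b ^ 17)⁻¹ / 2 ^ d ≤ (4 * b ^ 17)⁻¹ :=
          div_le_self (by positivity) (one_le_pow₀ one_le_two)
      _ ≤ 1 := inv_le_one_of_one_le₀ (by linarith [one_le_pow₀ hb1 (n := 17)])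
      _ < 4 * b ^ 11 := by linarith [one_le_pow₀ hb1 (n := 11)]
  · rw [← coe_ofReal_mul_tsum_lintegral_pairLaw (by positivity) (fun _ => sq_nonneg _)
      (h.integrable_sq_sub hτ hτ₀ hdecay), ENNReal.ofReal_div_of_pos (by positivity),
      ENNReal.ofReal_pow zero_le_two, ENNReal.ofReal_ofNat]
    refine hX.enumeration.le_liminf_of_gridAverage_le hd ENNReal.ofReal_ne_top fun n => ?_
    rw [← hdist n hτ]
    exact le_looExcess hX hY (h.continuous hτ) (h.continuous hτ₀) (hone hτ) (hone hτ₀)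
      (hcond n hτ) (hcond n hτ₀)
  · rw [← coe_ofReal_mul_tsum_lintegral_pairLaw (by positivity) (fun _ => sq_nonneg _)
      (h.integrable_sq_sub hτ hτ₀ hdecay)]
    refine limsup_le_of_le_gridAverage (hX.enumeration.injective hd) fun n => ?_
    rw [← hdist n hτ]
    exact looExcess_le hX hY (h.continuous hτ) (h.continuous hτ₀) (hcond n hτ) (hcond n hτ₀)

end SpectralFamily

/-! ### Comparison with the domain of differences -/

section Compactness

lemma exists_mul_le_and_le_mul_of_isCompact {T : Type*} [TopologicalSpace T] {S : Set T}
    (hS : IsCompact S) {I J : T → ℝ} (hI : ContinuousOn I S) (hJ : ContinuousOn J S)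
    (hJ₀ : ∀ τ ∈ S, 0 ≤ J τ) (hJI : ∀ τ ∈ S, J τ = 0 ↔ I τ = 0) {δ : ℝ} (hδ : 0 < δ) :
    ∃ a b : ℝ, 0 < a ∧ a ≤ b ∧
      ∀ τ ∈ S, I τ = 0 ∨ δ ≤ I τ → a * I τ ≤ J τ ∧ J τ ≤ b * I τ := by
  -- The quotient below is continuous and positive on `S`, and is `J / I` where `δ ≤ I`.
  have hden (τ : T) : 0 < max (I τ) δ := lt_max_of_lt_right hδ
  have hcont : ContinuousOn (fun τ => (J τ + max (δ - I τ) 0) / max (I τ) δ) S :=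
    (hJ.add ((continuousOn_const.sub hI).sup continuousOn_const)).div
      (hI.sup continuousOn_const) fun τ _ => (hden τ).ne'
  have hpos (τ : T) (hτ : τ ∈ S) : 0 < (J τ + max (δ - I τ) 0) / max (I τ) δ := by
    refine div_pos ?_ (hden τ)
    rcases (hJ₀ τ hτ).eq_or_lt with h0 | h0
    · rw [← h0, (hJI τ hτ).1 h0.symm]
      simpa using hδ
    · positivity
  obtain ⟨a, ha, ha_le⟩ := hS.exists_forall_le' hcont hpos
  obtain ⟨b, hb⟩ := hS.bddAbove_image hcont
  refine ⟨a, max a b, ha, le_max_left a b, fun τ hτ => ?_⟩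
  rintro (h0 | hle)
  · simp [h0, (hJI τ hτ).2 h0]
  · have hlower := ha_le τ hτ
    have hupper := (hb (Set.mem_image_of_mem _ hτ)).trans (le_max_right a b)
    simp only [max_eq_left hle, max_eq_right (sub_nonpos.2 hle), add_zero] at hlower hupper
    have hIpos := hδ.trans_le hle
    exact ⟨(le_div_iff₀ hIpos).1 hlower, (div_le_iff₀ hIpos).1 hupper⟩

end Compactness

section Bounds

variable {d : ℕ} {T : Type*} [TopologicalSpace T] {S : Set T}
  {k g : T → EuclideanSpace ℝ (Fin d) → ℝ} {v : ℕ → Fin d → ℤ} {ε : ℝ}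
  {μ : Measure (EuclideanSpace ℝ (Fin d))} {ΩX ΩY : Type*} [MeasurableSpace ΩX]
  [MeasurableSpace ΩY] {X : ℕ → ΩX → EuclideanSpace ℝ (Fin d)} {PX : Measure ΩX}
  [IsProbabilityMeasure PX] {Y : EuclideanSpace ℝ (Fin d) → ΩY → ℝ} {PY : Measure ΩY}

lemma IsSpectralFamily.exists_looExcess_bounds_tsum (h : IsSpectralFamily S k g)
    (hS : IsCompact S) (hd : 0 < d) (hX : IsPerturbedGrid v 0 μ X PX) {τ₀ : T} (hτ₀ : τ₀ ∈ S)
    (hY : IsCenteredGaussianField (k τ₀) Y PY) :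
    ∃ A B : ℝ, 0 < A ∧ A < B ∧ ∀ τ ∈ S,
      Summable (fun w => (k τ (latticePoint w) - k τ₀ (latticePoint w)) ^ 2) ∧
      ((A * ∑' w, (k τ (latticePoint w) - k τ₀ (latticePoint w)) ^ 2 : ℝ) : EReal) ≤
        liminf (fun n => looExcess (k τ) (k τ₀) v 0 X PX Y PY n) atTop ∧
      limsup (fun n => looExcess (k τ) (k τ₀) v 0 X PX Y PY n) atTop ≤
        ((B * ∑' w, (k τ (latticePoint w) - k τ₀ (latticePoint w)) ^ 2 : ℝ) : EReal) := by
  have hμ := hX.isProbabilityMeasure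
  have hdecay := integrable_decay_pairMeasure hX.support_subset hX.scale_nonneg hX.scale_lt
  obtain ⟨A, B, hA, hAB, hbounds⟩ := h.exists_looExcess_bounds hS hd hX hτ₀ hY
  refine ⟨A, B, hA, hAB, fun τ hτ => ?_⟩
  have hsum := hasSum_latticePoint (g := fun t => (k τ t - k τ₀ t) ^ 2)
    (by simp [h.apply_zero τ hτ, h.apply_zero τ₀ hτ₀]) (h.integrable_sq_sub hτ hτ₀ hdecay)
  rw [hsum.tsum_eq]
  exact ⟨hsum.summable, hbounds τ hτ⟩

lemma IsSpectralFamily.exists_looExcess_bounds_setIntegral [FirstCountableTopology T]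
    (h : IsSpectralFamily S k g) (hS : IsCompact S) (hd : 0 < d)
    (hX : IsPerturbedGrid v ε μ X PX) (hε : ε ≠ 0) (hμ : μ ≪ volume) {τ₀ : T} (hτ₀ : τ₀ ∈ S)
    (hY : IsCenteredGaussianField (k τ₀) Y PY) {δ : ℝ} (hδ : 0 < δ) :
    ∃ A B : ℝ, 0 < A ∧ A < B ∧ ∀ τ ∈ S,
      ((∫ t in diffDomain ε μ.support, (k τ t - k τ₀ t) ^ 2) = 0 ∨
        δ ≤ ∫ t in diffDomain ε μ.support, (k τ t - k τ₀ t) ^ 2) →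
      ((A * ∫ t in diffDomain ε μ.support, (k τ t - k τ₀ t) ^ 2 : ℝ) : EReal) ≤
        liminf (fun n => looExcess (k τ) (k τ₀) v ε X PX Y PY n) atTop ∧
      limsup (fun n => looExcess (k τ) (k τ₀) v ε X PX Y PY n) atTop ≤
        ((B * ∫ t in diffDomain ε μ.support, (k τ t - k τ₀ t) ^ 2 : ℝ) : EReal) := by
  have hμ_prob := hX.isProbabilityMeasure
  have hdecay := integrable_decay_pairMeasure hX.support_subset hX.scale_nonneg hX.scale_lt
  have hdecayD := (integrable_decay (d := d)).integrableOn (s := diffDomain ε μ.support)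
  obtain ⟨κ₁, κ₂, hκ₁, hκ, hbounds⟩ := h.exists_looExcess_bounds hS hd hX hτ₀ hY
  have hzero (τ : T) (hτ : τ ∈ S) : ∫ t, (k τ t - k τ₀ t) ^ 2 ∂(pairMeasure μ ε) = 0 ↔
      ∫ t in diffDomain ε μ.support, (k τ t - k τ₀ t) ^ 2 = 0 :=
    integral_pairMeasure_eq_zero_iff hμ hε (((h.continuous hτ).sub (h.continuous hτ₀)).pow 2)
      (fun _ => sq_nonneg _) (h.integrable_sq_sub hτ hτ₀ hdecay)
      (h.integrable_sq_sub hτ hτ₀ hdecayD)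
  obtain ⟨a, b, ha, hab, hcompare⟩ := exists_mul_le_and_le_mul_of_isCompact hS
    (h.continuousOn_integral_sq_sub hτ₀ hdecayD) (h.continuousOn_integral_sq_sub hτ₀ hdecay)
    (fun _ _ => integral_nonneg fun _ => sq_nonneg _) hzero hδ
  refine ⟨κ₁ * a, κ₂ * b, by positivity,
    mul_lt_mul hκ hab ha (hκ₁.trans hκ).le, fun τ hτ hI => ?_⟩
  obtain ⟨hlower, hupper⟩ := hcompare τ hτ hI
  have hκ₂ : 0 < κ₂ := hκ₁.trans hκ
  refine ⟨le_trans ?_ (hbounds τ hτ).1, (hbounds τ hτ).2.trans ?_⟩ <;>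
    rw [EReal.coe_le_coe_iff, mul_assoc] <;> gcongr

end Bounds

section RegularModel

variable {d p : ℕ} {θinf θsup : ℝ} {K : (Fin p → ℝ) → EuclideanSpace ℝ (Fin d) → ℝ}

lemma RegularModel.exists_abs_le_decay (hK : RegularModel θinf θsup K) :
    ∃ C, 0 ≤ C ∧ ∀ θ ∈ paramSet p θinf θsup, ∀ t, |K θ t| ≤ C * decay d t := by
  obtain ⟨C, hC⟩ := hK.bound [] (Nat.zero_le 3)
  refine ⟨max C 0, le_max_right C 0, fun θ hθ t => (hC θ hθ t).trans ?_⟩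
  rw [decay, mul_one_div]
  gcongr
  exact le_max_left C 0

lemma RegularModel.eq_cosTransform (hK : RegularModel θinf θsup K) {θ : Fin p → ℝ}
    (hθ : θ ∈ paramSet p θinf θsup) : K θ = cosTransform fun f => (fourierHat (K θ) f).re := by
  funext t
  have hint : Integrable fun f : EuclideanSpace ℝ (Fin d) =>
      fourierHat (K θ) f * Complex.exp (Complex.I * ((inner ℝ f t : ℝ) : ℂ)) := by
    refine (hK.integrable_hat θ hθ).mul_bdd (c := 1) (by fun_prop) (.of_forall fun f => ?_)
    rw [mul_comm, Complex.norm_exp_ofReal_mul_I]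
  calc K θ t = (∫ f, fourierHat (K θ) f *
        Complex.exp (Complex.I * ((inner ℝ f t : ℝ) : ℂ))).re := by
        rw [← hK.inversion θ hθ t, Complex.ofReal_re]
    _ = ∫ f, (fourierHat (K θ) f * Complex.exp (Complex.I * ((inner ℝ f t : ℝ) : ℂ))).re :=
        (integral_re hint).symm
    _ = cosTransform (fun f => (fourierHat (K θ) f).re) t := by
        refine integral_congr_ae (.of_forall fun f => ?_)
        simp [Complex.mul_re, (hK.pos_hat θ hθ f).1, mul_comm Complex.I,
          Complex.exp_ofReal_mul_I_re]

lemma RegularModel.isSpectralFamily (hK : RegularModel θinf θsup K)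
    (hcorr : ∀ θ ∈ paramSet p θinf θsup, K θ 0 = 1) :
    IsSpectralFamily (paramSet p θinf θsup) K fun θ f => (fourierHat (K θ) f).re where
  exists_abs_le := hK.exists_abs_le_decay
  apply_zero := hcorr
  eq_cosTransform _ := hK.eq_cosTransform
  integrable θ hθ := (hK.integrable_hat θ hθ).re
  pos θ hθ f := (hK.pos_hat θ hθ f).2
  continuousOn := Complex.continuous_re.comp_continuousOn hK.continuous_hat

lemma IsPerturbationLaw.absolutelyContinuous {μ : Measure (EuclideanSpace ℝ (Fin d))}
    (hμ : IsPerturbationLaw μ) : μ ≪ volume := by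
  obtain ⟨f, -, hf, -⟩ := hμ.density
  exact hf ▸ withDensity_absolutelyContinuous volume f

end RegularModel

end KrigingLOO

open KrigingLOO in
theorem mainTheorem9_general {d : ℕ} {T : Type*} [TopologicalSpace T] [FirstCountableTopology T]
    (hd : 0 < d) {S : Set T} (hS : IsCompact S) {K g : T → EuclideanSpace ℝ (Fin d) → ℝ}
    (hK : IsSpectralFamily S K g) {θ₀ : T} (hθ₀ : θ₀ ∈ S) {v : ℕ → Fin d → ℤ} {ε : ℝ}
    {μ : Measure (EuclideanSpace ℝ (Fin d))} (hμ : μ ≪ volume)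
    {ΩX ΩY : Type*} [MeasurableSpace ΩX] [MeasurableSpace ΩY]
    {PX : Measure ΩX} [IsProbabilityMeasure PX] {PY : Measure ΩY}
    {X : ℕ → ΩX → EuclideanSpace ℝ (Fin d)} (hX : IsPerturbedGrid v ε μ X PX)
    {Y : EuclideanSpace ℝ (Fin d) → ΩY → ℝ}
    (hY : IsCenteredGaussianField (K θ₀) Y PY) :
    (ε = 0 → ∃ A B : ℝ, 0 < A ∧ A < B ∧ ∀ θ ∈ S,
      Summable (fun w : Fin d → ℤ =>
        (K θ (latticePoint w) - K θ₀ (latticePoint w)) ^ 2) ∧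
      ((A * ∑' w : Fin d → ℤ,
          (K θ (latticePoint w) - K θ₀ (latticePoint w)) ^ 2 : ℝ) : EReal)
        ≤ liminf (fun n : ℕ => looExcess (K θ) (K θ₀) v ε X PX Y PY n) atTop ∧
      limsup (fun n : ℕ => looExcess (K θ) (K θ₀) v ε X PX Y PY n) atTop
        ≤ ((B * ∑' w : Fin d → ℤ,
          (K θ (latticePoint w) - K θ₀ (latticePoint w)) ^ 2 : ℝ) : EReal))
    ∧
    (ε ≠ 0 →
      (∀ θ ∈ S,
        IntegrableOn (fun t => (K θ t - K θ₀ t) ^ 2) (diffDomain ε μ.support)) ∧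
      ∀ δ : ℝ, 0 < δ → ∃ A B : ℝ, 0 < A ∧ A < B ∧ ∀ θ ∈ S,
        ((∫ t in diffDomain ε μ.support, (K θ t - K θ₀ t) ^ 2) = 0 ∨
          δ ≤ ∫ t in diffDomain ε μ.support, (K θ t - K θ₀ t) ^ 2) →
        ((A * ∫ t in diffDomain ε μ.support, (K θ t - K θ₀ t) ^ 2 : ℝ) : EReal)
          ≤ liminf (fun n : ℕ => looExcess (K θ) (K θ₀) v ε X PX Y PY n) atTop ∧
        limsup (fun n : ℕ => looExcess (K θ) (K θ₀) v ε X PX Y PY n) atTop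
          ≤ ((B * ∫ t in diffDomain ε μ.support, (K θ t - K θ₀ t) ^ 2 : ℝ) : EReal)) := by
  refine ⟨?_, fun hε => ⟨fun θ hθ => ?_, fun δ hδ => ?_⟩⟩
  · rintro rfl
    exact hK.exists_looExcess_bounds_tsum hS hd hX hθ₀ hY
  · exact hK.integrable_sq_sub hθ hθ₀ integrable_decay.integrableOn
  · exact hK.exists_looExcess_bounds_setIntegral hS hd hX hε hμ hθ₀ hY hδ

theorem mainTheorem9 {d p : ℕ} (hd : 0 < d) (θinf θsup : ℝ)
    (K : (Fin p → ℝ) → EuclideanSpace ℝ (Fin d) → ℝ)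
    (hK : KrigingLOO.RegularModel θinf θsup K)
    (hcorr : ∀ θ ∈ KrigingLOO.paramSet p θinf θsup, K θ 0 = 1)
    (θ₀ : Fin p → ℝ) (hθ₀ : ∀ i, θinf < θ₀ i ∧ θ₀ i < θsup)
    (v : ℕ → Fin d → ℤ) (hv : KrigingLOO.IsGridEnumeration v)
    (ε : ℝ) (hε_nonneg : 0 ≤ ε) (hε_lt : ε < 1 / 2)
    (μ : Measure (EuclideanSpace ℝ (Fin d))) (hμ : KrigingLOO.IsPerturbationLaw μ)
    {ΩX ΩY : Type*} [MeasurableSpace ΩX] [MeasurableSpace ΩY]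
    (PX : Measure ΩX) [IsProbabilityMeasure PX] (PY : Measure ΩY) [IsProbabilityMeasure PY]
    (X : ℕ → ΩX → EuclideanSpace ℝ (Fin d)) (hX_meas : ∀ i, Measurable (X i))
    (hX_indep : iIndepFun X PX) (hX_law : ∀ i, PX.map (X i) = μ)
    (Y : EuclideanSpace ℝ (Fin d) → ΩY → ℝ)
    (hY : KrigingLOO.IsCenteredGaussianField (K θ₀) Y PY) :
    (ε = 0 → ∃ A B : ℝ, 0 < A ∧ A < B ∧ ∀ θ ∈ KrigingLOO.paramSet p θinf θsup,
      Summable (fun w : Fin d → ℤ =>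
        (K θ (KrigingLOO.latticePoint w) - K θ₀ (KrigingLOO.latticePoint w)) ^ 2) ∧
      ((A * ∑' w : Fin d → ℤ,
          (K θ (KrigingLOO.latticePoint w) - K θ₀ (KrigingLOO.latticePoint w)) ^ 2 : ℝ) : EReal)
        ≤ liminf (fun n : ℕ => KrigingLOO.looExcess (K θ) (K θ₀) v ε X PX Y PY n) atTop ∧
      limsup (fun n : ℕ => KrigingLOO.looExcess (K θ) (K θ₀) v ε X PX Y PY n) atTop
        ≤ ((B * ∑' w : Fin d → ℤ,
          (K θ (KrigingLOO.latticePoint w) - K θ₀ (KrigingLOO.latticePoint w)) ^ 2 : ℝ) : EReal))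
    ∧
    (ε ≠ 0 →
      (∀ θ ∈ KrigingLOO.paramSet p θinf θsup,
        IntegrableOn (fun t => (K θ t - K θ₀ t) ^ 2) (KrigingLOO.diffDomain ε μ.support)) ∧
      ∀ δ : ℝ, 0 < δ → ∃ A B : ℝ, 0 < A ∧ A < B ∧ ∀ θ ∈ KrigingLOO.paramSet p θinf θsup,
        ((∫ t in KrigingLOO.diffDomain ε μ.support, (K θ t - K θ₀ t) ^ 2) = 0 ∨
          δ ≤ ∫ t in KrigingLOO.diffDomain ε μ.support, (K θ t - K θ₀ t) ^ 2) →
        ((A * ∫ t in KrigingLOO.diffDomain ε μ.support, (K θ t - K θ₀ t) ^ 2 : ℝ) : EReal)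
          ≤ liminf (fun n : ℕ => KrigingLOO.looExcess (K θ) (K θ₀) v ε X PX Y PY n) atTop ∧
        limsup (fun n : ℕ => KrigingLOO.looExcess (K θ) (K θ₀) v ε X PX Y PY n) atTop
          ≤ ((B * ∫ t in KrigingLOO.diffDomain ε μ.support, (K θ t - K θ₀ t) ^ 2 : ℝ) : EReal)) := by
  exact mainTheorem9_general hd isCompact_Icc (hK.isSpectralFamily hcorr)
    ⟨fun i => (hθ₀ i).1.le, fun i => (hθ₀ i).2.le⟩ hμ.absolutelyContinuous
    ⟨hv, hε_nonneg, hε_lt, hμ.support_subset, hX_meas, fun _ _ h => hX_indep.indepFun h, hX_law⟩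
    hY
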